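/- All graphs are finite and simple; the eigenvalues of a graph are those of its adjacency matrix, counted with multiplicity, its index is its largest eigenvalue, and a graph is cyclotomic if all its eigenvalues lie in $[-2,2]$ (the graph without vertices is cyclotomic and is given index $0$). A graph is called minimal of index greater than $2$ if its index is greater than $2$ and every proper induced subgraph has index at most $2$. Up to isomorphism there are exactly $18$ minimal graphs of index greater than $2$, namely: $K_4$; $K_4$ minus an edge; $K_{2,3}$; the cycles $C_n$ with one pendant edge attached, for $3\leqslant n\leqslant 8$; the star $K_{1,5}$; the graphs obtained from $\tilde D_n$, for $4\leqslant n\leqslant 8$, by attaching a pendant edge at a leaf (here $\tilde D_n$ is the tree on $n+1$ vertices obtained from a path on $n-3$ vertices by attaching two pendant edges at each end, so $\tilde D_4=K_{1,4}$); and the three trees consisting of three paths with one common end vertex and with $2,2,3$, with $1,3,4$, and with $1,2,6$ edges, respectively. Let $G$ be a connected graph with vertex set $V(G)$, having index $\lambda>2$ and second largest eigenvalue at most $2$. Then: (a) $V(G)$ is a disjoint union $V(G)=M\cup A\cup H$ ($A$ and $H$ possibly empty) such that - the induced subgraph $G|_M$ is one of these $18$ graphs (up to isomorphism), hence minimal of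 index greater than $2$, and it has exactly one eigenvalue greater than $2$; - $A$ is the set of all vertices outside $M$ that are adjacent in $G$ to some vertex of $M$; - the induced subgraph $G|_H$ is cyclotomic. (b) $G$ has at most $B:=10(3\lambda^4+\lambda^2+1)$ vertices of degree greater than $2$, and at most $\lambda^2B$ vertices of degree $1$. -/

import Mathlib

namespace GraphIndex

open Classical in
/-- The eigenvalues of a finite simple graph, i.e. those of its real adjacency matrix, listed with
multiplicity in non-increasing order. -/
noncomputable def eigenvalue {V : Type*} [Fintype V] (G : SimpleGraph V) :
    Fin (Fintype.card V) → ℝ :=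
  Matrix.IsHermitian.eigenvalues₀ (A := G.adjMatrix ℝ) (by
    rw [Matrix.IsHermitian, Matrix.conjTranspose_eq_transpose_of_trivial]
    exact G.isSymm_adjMatrix)

/-- The index of a graph: its largest eigenvalue (`0` for the graph without vertices). -/
noncomputable def index {V : Type*} [Fintype V] (G : SimpleGraph V) : ℝ :=
  if h : 0 < Fintype.card V then eigenvalue G ⟨0, h⟩ else 0

/-- The second largest eigenvalue of a graph, counted with multiplicity
(`0` for a graph with fewer than two vertices). -/
noncomputable def secondEigenvalue {V : Type*} [Fintype V] (G : SimpleGraph V) : ℝ :=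
  if h : 1 < Fintype.card V then eigenvalue G ⟨1, h⟩ else 0

/-- A graph is cyclotomic if all its eigenvalues lie in the interval `[-2, 2]`. -/
def IsCyclotomic {V : Type*} [Fintype V] (G : SimpleGraph V) : Prop :=
  ∀ i, eigenvalue G i ∈ Set.Icc (-2 : ℝ) 2

/-- A graph is minimal with respect to the property of having index greater than `2`: it has this
property, but no proper vertex-deleted (induced) subgraph has it. -/
def IsMinimalIndexGtTwo {V : Type*} [Fintype V] (G : SimpleGraph V) : Prop :=
  2 < index G ∧ ∀ s : Finset V, s ≠ Finset.univ → index (G.induce (s : Set V)) ≤ 2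

/-- The simple graph on `{0, …, n - 1}` whose edges are given by a list of pairs of endpoints. -/
def ofEdges (n : ℕ) (l : List (ℕ × ℕ)) : SimpleGraph (Fin n) where
  Adj a b := a ≠ b ∧ (((a : ℕ), (b : ℕ)) ∈ l ∨ ((b : ℕ), (a : ℕ)) ∈ l)
  symm := ⟨fun _ _ h => ⟨h.1.symm, h.2.symm⟩⟩
  loopless := ⟨fun _ h => h.1 rfl⟩

/-- The numbers of vertices of the 18 minimal graphs of index greater than `2`. -/
def minimalOrder : Fin 18 → ℕ :=
  ![4, 4, 5, 4, 5, 6, 7, 8, 9, 6, 6, 7, 8, 9, 10, 8, 9, 10]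

/-- The edges of the 18 minimal graphs of index greater than `2`. In this order:
* the complete graph on 4 vertices, the same with one edge removed, and the complete bipartite
  graph with parts of sizes 2 and 3;
* the cycles of lengths 3, 4, 5, 6, 7, 8 with one pendant edge attached;
* the star with 5 edges;
* the path with `k` vertices, `k = 1, …, 5`, in which two pendant edges are attached to each of
  its two ends (four of them to the single vertex for `k = 1`), with one further edge attached to
  one of these four leaves;
* the trees consisting of three paths with a common end vertex, with `2, 2, 3`, with `1, 3, 4` and
  with `1, 2, 6` edges. -/
def minimalEdges : Fin 18 → List (ℕ × ℕ) :=
  ![[(0, 1), (0, 2), (0, 3), (1, 2), (1, 3), (2, 3)],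
    [(0, 1), (0, 2), (0, 3), (1, 2), (1, 3)],
    [(0, 2), (0, 3), (0, 4), (1, 2), (1, 3), (1, 4)],
    [(0, 1), (1, 2), (2, 0), (0, 3)],
    [(0, 1), (1, 2), (2, 3), (3, 0), (0, 4)],
    [(0, 1), (1, 2), (2, 3), (3, 4), (4, 0), (0, 5)],
    [(0, 1), (1, 2), (2, 3), (3, 4), (4, 5), (5, 0), (0, 6)],
    [(0, 1), (1, 2), (2, 3), (3, 4), (4, 5), (5, 6), (6, 0), (0, 7)],
    [(0, 1), (1, 2), (2, 3), (3, 4), (4, 5), (5, 6), (6, 7), (7, 0), (0, 8)],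
    [(0, 1), (0, 2), (0, 3), (0, 4), (0, 5)],
    [(0, 1), (0, 2), (0, 3), (0, 4), (4, 5)],
    [(0, 1), (0, 2), (0, 3), (1, 4), (1, 5), (5, 6)],
    [(0, 1), (1, 2), (0, 3), (0, 4), (2, 5), (2, 6), (6, 7)],
    [(0, 1), (1, 2), (2, 3), (0, 4), (0, 5), (3, 6), (3, 7), (7, 8)],
    [(0, 1), (1, 2), (2, 3), (3, 4), (0, 5), (0, 6), (4, 7), (4, 8), (8, 9)],
    [(0, 1), (1, 2), (0, 3), (3, 4), (0, 5), (5, 6), (6, 7)],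
    [(0, 1), (0, 2), (2, 3), (3, 4), (0, 5), (5, 6), (6, 7), (7, 8)],
    [(0, 1), (0, 2), (2, 3), (0, 4), (4, 5), (5, 6), (6, 7), (7, 8), (8, 9)]]

/-- The 18 minimal graphs of index greater than `2`. -/
def minimalGraph (i : Fin 18) : SimpleGraph (Fin (minimalOrder i)) :=
  ofEdges (minimalOrder i) (minimalEdges i)

end GraphIndex

namespace GraphIndex

open Finset SimpleGraph

section Spectral

variable {V : Type*} [Fintype V] (G : SimpleGraph V)

open Classical in
/-- The quadratic form of the adjacency matrix of a graph. -/
noncomputable def quad (x : V → ℝ) : ℝ :=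
  ∑ u, ∑ w, if G.Adj u w then x u * x w else 0

theorem eigenvalue_antitone : Antitone (eigenvalue G) := by
  classical
  exact Matrix.IsHermitian.eigenvalues₀_antitone _

/-- The spectral theorem for the adjacency matrix of a graph, in coordinates. -/
theorem exists_orthonormal_eigenvectors :
    ∃ u : Fin (Fintype.card V) → V → ℝ,
      (∀ i j, ∑ v, u i v * u j v = if i = j then 1 else 0) ∧
      (∀ x, quad G x = ∑ i, eigenvalue G i * (∑ v, u i v * x v) ^ 2) ∧
      (∀ x : V → ℝ, ∑ v, x v ^ 2 = ∑ i, (∑ v, u i v * x v) ^ 2) := by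
  classical
  have hA : (G.adjMatrix ℝ).IsHermitian := by
    rw [Matrix.IsHermitian, Matrix.conjTranspose_eq_transpose_of_trivial]
    exact G.isSymm_adjMatrix
  let e : Fin (Fintype.card V) ≃ V := Fintype.equivOfCardEq (Fintype.card_fin _)
  let b := hA.eigenvectorBasis
  have hev : ∀ i, hA.eigenvalues (e i) = eigenvalue G i := fun i => by
    simp [Matrix.IsHermitian.eigenvalues, eigenvalue, e]
  have hinner : ∀ x y : EuclideanSpace ℝ V, inner ℝ x y = ∑ v, x v * y v := fun x y => by
    simp [PiLp.inner_apply, mul_comm]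
  have hpars : ∀ x y : V → ℝ, ∑ v, x v * y v =
      ∑ i, (∑ v, b (e i) v * x v) * (∑ v, b (e i) v * y v) := fun x y => by
    have h := b.sum_inner_mul_inner (WithLp.toLp 2 x) (WithLp.toLp 2 y)
    simp only [hinner] at h
    rw [← h, ← e.sum_comp]
    refine Finset.sum_congr rfl fun i _ => ?_
    simp only [mul_comm]
  refine ⟨fun i => b (e i), fun i j => ?_, fun x => ?_, fun x => ?_⟩
  · rw [← hinner, b.inner_eq_ite]
    simp
  · have hq : quad G x = ∑ v, x v * (G.adjMatrix ℝ).mulVec x v := by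
      simp only [quad, Matrix.mulVec, dotProduct, Finset.mul_sum, adjMatrix_apply]
      refine Finset.sum_congr rfl fun u _ => Finset.sum_congr rfl fun w _ => ?_
      split_ifs <;> simp
    rw [hq, hpars]
    refine Finset.sum_congr rfl fun i _ => ?_
    have h2 : ∑ v, b (e i) v * (G.adjMatrix ℝ).mulVec x v =
        eigenvalue G i * ∑ v, b (e i) v * x v := by
      have h3 := hA.mulVec_eigenvectorBasis (e i)
      have h4 : (⇑(b (e i)) : V → ℝ) ⬝ᵥ (G.adjMatrix ℝ).mulVec x
          = ((G.adjMatrix ℝ).mulVec ⇑(b (e i))) ⬝ᵥ x := by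
        rw [Matrix.dotProduct_mulVec, ← Matrix.mulVec_transpose, G.transpose_adjMatrix]
      change (⇑(b (e i)) : V → ℝ) ⬝ᵥ (G.adjMatrix ℝ).mulVec x = _
      rw [h4, h3, hev, smul_dotProduct, smul_eq_mul]
      rfl
    rw [h2]; ring
  · have := hpars x x
    simpa only [← sq] using this

variable {G}

theorem quad_le_index (x : V → ℝ) : quad G x ≤ index G * ∑ v, x v ^ 2 := by
  obtain ⟨u, -, h2, h3⟩ := exists_orthonormal_eigenvectors G
  rw [h2, h3, Finset.mul_sum]
  refine Finset.sum_le_sum fun i _ => mul_le_mul_of_nonneg_right ?_ (sq_nonneg _)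
  have hpos : 0 < Fintype.card V := i.pos
  rw [index, dif_pos hpos]
  exact eigenvalue_antitone G (Fin.mk_le_of_le_val (Nat.zero_le _))

/-- Each eigenvalue is the value of the quadratic form at a unit vector. -/
theorem exists_quad_eq_eigenvalue (i : Fin (Fintype.card V)) :
    ∃ x : V → ℝ, ∑ v, x v ^ 2 = 1 ∧ quad G x = eigenvalue G i := by
  obtain ⟨u, h1, h2, h3⟩ := exists_orthonormal_eigenvectors G
  refine ⟨u i, ?_, ?_⟩
  · simpa [← sq] using h1 i i
  · rw [h2]
    simp [h1]

/-- Two different eigenvalues above `c` give a plane on which the quadratic form is above `c`; it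
contains a nonzero vector vanishing at a given vertex. -/
theorem exists_lt_quad_of_two_eigenvalues {c : ℝ} {i j : Fin (Fintype.card V)} (hij : i ≠ j)
    (hi : c < eigenvalue G i) (hj : c < eigenvalue G j) (v : V) :
    ∃ x : V → ℝ, x v = 0 ∧ c * ∑ w, x w ^ 2 < quad G x := by
  obtain ⟨u, h1, h2, h3⟩ := exists_orthonormal_eigenvectors G
  obtain ⟨a, b, hab, h0⟩ : ∃ a b : ℝ, (a ≠ 0 ∨ b ≠ 0) ∧ a * u i v + b * u j v = 0 := by
    by_cases h : u i v = 0
    · exact ⟨1, 0, by simp, by simp [h]⟩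
    · exact ⟨- u j v, u i v, Or.inr h, by ring⟩
  refine ⟨fun w => a * u i w + b * u j w, h0, ?_⟩
  have hk : ∀ k, ∑ w, u k w * (a * u i w + b * u j w) =
      a * (if k = i then 1 else 0) + b * (if k = j then 1 else 0) := fun k => by
    rw [← h1, ← h1, Finset.mul_sum, Finset.mul_sum, ← Finset.sum_add_distrib]
    exact Finset.sum_congr rfl fun w _ => by ring
  have hsum : ∀ f : Fin (Fintype.card V) → ℝ,
      ∑ k, f k * (∑ w, u k w * (a * u i w + b * u j w)) ^ 2 = f i * a ^ 2 + f j * b ^ 2 := by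
    intro f
    have : ∀ k, f k * (∑ w, u k w * (a * u i w + b * u j w)) ^ 2 =
        (if k = i then f k * a ^ 2 else 0) + (if k = j then f k * b ^ 2 else 0) := fun k => by
      rw [hk]
      by_cases hki : k = i
      · have : k ≠ j := fun h => hij (hki ▸ h)
        simp [hki, hij]
      · simp [hki]
    simp [this, Finset.sum_add_distrib]
  rw [h2, h3, hsum]
  have := hsum 1
  simp only [Pi.one_apply, one_mul] at this
  rw [this]
  rcases hab with h | h
  · have := sq_pos_of_ne_zero h
    nlinarith [sq_nonneg b]
  · have := sq_pos_of_ne_zero h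
    nlinarith [sq_nonneg a]

/-- If the quadratic form exceeds `c` on the whole plane spanned by two vectors, then the second
largest eigenvalue exceeds `c`. -/
theorem lt_secondEigenvalue {c : ℝ} (x y : V → ℝ)
    (h : ∀ a b : ℝ, a ≠ 0 ∨ b ≠ 0 →
      c * ∑ v, (a * x v + b * y v) ^ 2 < quad G (fun v => a * x v + b * y v))
    (hc : 1 < Fintype.card V) : c < secondEigenvalue G := by
  obtain ⟨u, h1, h2, h3⟩ := exists_orthonormal_eigenvectors G
  rw [secondEigenvalue, dif_pos hc]
  let i₀ : Fin (Fintype.card V) := ⟨0, by omega⟩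
  obtain ⟨a, b, hab, h0⟩ : ∃ a b : ℝ, (a ≠ 0 ∨ b ≠ 0) ∧
      ∑ v, u i₀ v * (a * x v + b * y v) = 0 := by
    have key : ∀ a b : ℝ, ∑ v, u i₀ v * (a * x v + b * y v) =
        a * ∑ v, u i₀ v * x v + b * ∑ v, u i₀ v * y v := fun a b => by
      rw [Finset.mul_sum, Finset.mul_sum, ← Finset.sum_add_distrib]
      exact Finset.sum_congr rfl fun w _ => by ring
    by_cases h : ∑ v, u i₀ v * x v = 0
    · exact ⟨1, 0, by simp, by rw [key]; simp [h]⟩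
    · exact ⟨- ∑ v, u i₀ v * y v, ∑ v, u i₀ v * x v, Or.inr h, by rw [key]; ring⟩
  have hlt := h a b hab
  rw [h2, h3] at hlt
  by_contra hcon
  push Not at hcon
  refine absurd hlt (not_lt.mpr ?_)
  rw [Finset.mul_sum]
  refine Finset.sum_le_sum fun i _ => ?_
  by_cases hi : i = i₀
  · rw [hi, h0]; simp
  · refine mul_le_mul_of_nonneg_right (le_trans ?_ hcon) (sq_nonneg _)
    refine eigenvalue_antitone G (Fin.mk_le_of_le_val ?_)
    have : (i : ℕ) ≠ 0 := fun h => hi (Fin.ext h)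
    omega

theorem index_le_of_quad_le {c : ℝ} (hc : 0 ≤ c) (h : ∀ x : V → ℝ, quad G x ≤ c * ∑ v, x v ^ 2) :
    index G ≤ c := by
  unfold index
  split_ifs with h0
  · obtain ⟨x, hx, hq⟩ := exists_quad_eq_eigenvalue (G := G) ⟨0, h0⟩
    rw [← hq]
    simpa [hx] using h x
  · exact hc

theorem lt_index_of_lt_quad {c : ℝ} (x : V → ℝ) (h : c * ∑ v, x v ^ 2 < quad G x) :
    c < index G := by
  have := h.trans_le (quad_le_index x)
  by_contra hcon
  push Not at hcon
  exact absurd this (not_lt.mpr (mul_le_mul_of_nonneg_right hcon (by positivity)))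

theorem exists_lt_quad_of_lt_index {c : ℝ} (hc : 0 ≤ c) (h : c < index G) :
    ∃ x : V → ℝ, c * ∑ v, x v ^ 2 < quad G x := by
  by_contra! hcon
  exact absurd h (not_lt.mpr (index_le_of_quad_le hc hcon))

theorem abs_quad_le_quad_abs (x : V → ℝ) : |quad G x| ≤ quad G (fun v => |x v|) := by
  unfold quad
  refine (Finset.abs_sum_le_sum_abs _ _).trans (Finset.sum_le_sum fun u _ => ?_)
  refine (Finset.abs_sum_le_sum_abs _ _).trans (Finset.sum_le_sum fun w _ => ?_)
  split_ifs <;> simp [abs_mul]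

theorem isCyclotomic_of_index_le_two (h : index G ≤ 2) : IsCyclotomic G := by
  intro i
  obtain ⟨x, hx, hq⟩ := exists_quad_eq_eigenvalue (G := G) i
  have h1 := abs_quad_le_quad_abs (G := G) x
  have h2 := quad_le_index (G := G) (fun v => |x v|)
  simp only [sq_abs, hx, mul_one] at h2
  rw [hq] at h1
  exact Set.mem_Icc.mpr (abs_le.mp (h1.trans (h2.trans h)))

theorem sum_extend_mul {W : Type*} [Fintype W] {f : W → V} (hf : Function.Injective f)
    (x : W → ℝ) (g : V → ℝ) : ∑ v, Function.extend f x 0 v * g v = ∑ w, x w * g (f w) := by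
  refine (Fintype.sum_of_injective f hf _ _ (fun v hv => ?_) fun w => ?_).symm
  · rw [Function.extend_apply' _ _ _ (by simpa using hv)]
    simp
  · rw [hf.extend_apply]

theorem sum_sq_extend {W : Type*} [Fintype W] {f : W → V} (hf : Function.Injective f)
    (x : W → ℝ) : ∑ v, (Function.extend f x 0 v) ^ 2 = ∑ w, x w ^ 2 := by
  simp only [sq, sum_extend_mul hf, hf.extend_apply]

open Classical in
theorem quad_extend {W : Type*} [Fintype W] {f : W → V} (hf : Function.Injective f)
    (x : W → ℝ) : quad G (Function.extend f x 0) =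
      ∑ u, ∑ w, if G.Adj (f u) (f w) then x u * x w else 0 := by
  have h1 : quad G (Function.extend f x 0) = ∑ u, Function.extend f x 0 u *
      ∑ w, Function.extend f x 0 w * (if G.Adj u w then 1 else 0) := by
    unfold quad
    refine Finset.sum_congr rfl fun u _ => ?_
    rw [Finset.mul_sum]
    refine Finset.sum_congr rfl fun w _ => ?_
    split_ifs <;> simp
  rw [h1, sum_extend_mul hf]
  refine Finset.sum_congr rfl fun u _ => ?_
  rw [sum_extend_mul hf, Finset.mul_sum]
  refine Finset.sum_congr rfl fun w _ => ?_
  split_ifs <;> simp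

/-- The index is monotone with respect to (not necessarily induced) subgraphs. -/
theorem index_le_of_isContained {W : Type*} [Fintype W] {F : SimpleGraph W} (hG : 0 ≤ index G)
    (h : F ⊑ G) : index F ≤ index G := by
  classical
  obtain ⟨f⟩ := h
  have hf : Function.Injective f := f.injective
  refine index_le_of_quad_le hG fun x => ?_
  have h1 := quad_le_index (G := G) (Function.extend f (fun w => |x w|) 0)
  rw [sum_sq_extend hf, quad_extend hf] at h1
  simp only [sq_abs] at h1
  refine ((le_abs_self _).trans (abs_quad_le_quad_abs x)).trans (le_trans ?_ h1)
  unfold quad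
  refine Finset.sum_le_sum fun u _ => Finset.sum_le_sum fun w _ => ?_
  by_cases huw : F.Adj u w
  · have : G.Adj (f u) (f w) := f.toHom.map_adj huw
    simp [huw, this]
  · simp only [huw, if_false]
    split_ifs <;> positivity

theorem index_nonneg : 0 ≤ index G := by
  by_contra! h
  by_cases hV : Nonempty V
  · obtain ⟨v⟩ := hV
    classical
    have := quad_le_index (G := G) (Pi.single v 1)
    have h2 : quad G (Pi.single v 1) = 0 := by
      unfold quad
      refine Finset.sum_eq_zero fun u _ => Finset.sum_eq_zero fun w _ => ?_
      split_ifs with huw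
      · by_cases hu : u = v
        · subst hu
          simp [huw.ne']
        · simp [hu]
      · rfl
    have h3 : ∑ w, (Pi.single v 1 : V → ℝ) w ^ 2 = 1 := by
      simp [Pi.single_apply]
    rw [h2, h3] at this
    linarith
  · have : Fintype.card V = 0 := Fintype.card_eq_zero_iff.mpr (not_nonempty_iff.mp hV)
    simp [index, this] at h

theorem index_mono {W : Type*} [Fintype W] {F : SimpleGraph W} (h : F ⊑ G) :
    index F ≤ index G :=
  index_le_of_isContained index_nonneg h

theorem index_congr {W : Type*} [Fintype W] {F : SimpleGraph W} (e : F ≃g G) :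
    index F = index G :=
  le_antisymm (index_mono e.isContained) (index_mono e.isContained')

open Classical in
/-- A positive vector `y` with `A y ≤ 2 y` bounds the index by `2`. -/
theorem index_le_two_of_superharmonic (y : V → ℝ) (hy : ∀ v, 0 < y v)
    (h : ∀ v, ∑ w, (if G.Adj v w then y w else 0) ≤ 2 * y v) : index G ≤ 2 := by
  refine index_le_of_quad_le zero_le_two fun x => ?_
  have key : ∀ u w, (if G.Adj u w then x u * x w else 0) ≤
      ((if G.Adj u w then y w else 0) * (x u ^ 2 / y u) +
       (if G.Adj w u then y u else 0) * (x w ^ 2 / y w)) / 2 := fun u w => by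
    by_cases huw : G.Adj u w
    · have h1 := hy u
      have h2 := hy w
      have : (y w * (x u ^ 2 / y u) + y u * (x w ^ 2 / y w)) / 2 - x u * x w =
          (y w * x u - y u * x w) ^ 2 / (2 * (y u * y w)) := by
        field_simp
        ring
      have h3 : 0 ≤ (y w * x u - y u * x w) ^ 2 / (2 * (y u * y w)) := by positivity
      simp only [huw, huw.symm, if_true]
      linarith
    · have huw2 : ¬G.Adj w u := fun h => huw h.symm
      simp [huw, huw2]
  have hS : ∑ u, ∑ w, (if G.Adj u w then y w else 0) * (x u ^ 2 / y u) ≤ 2 * ∑ v, x v ^ 2 := by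
    rw [Finset.mul_sum]
    refine Finset.sum_le_sum fun u _ => ?_
    rw [← Finset.sum_mul]
    refine (mul_le_mul_of_nonneg_right (h u) (by have := hy u; positivity)).trans_eq ?_
    have := (hy u).ne'
    field_simp
  calc quad G x ≤ ∑ u, ∑ w, ((if G.Adj u w then y w else 0) * (x u ^ 2 / y u) +
        (if G.Adj w u then y u else 0) * (x w ^ 2 / y w)) / 2 :=
      Finset.sum_le_sum fun u _ => Finset.sum_le_sum fun w _ => key u w
    _ = (∑ u, ∑ w, (if G.Adj u w then y w else 0) * (x u ^ 2 / y u) +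
          ∑ u, ∑ w, (if G.Adj w u then y u else 0) * (x w ^ 2 / y w)) / 2 := by
      simp only [← Finset.sum_div, Finset.sum_add_distrib]
    _ = ∑ u, ∑ w, (if G.Adj u w then y w else 0) * (x u ^ 2 / y u) := by
      rw [Finset.sum_comm (f := fun u w => (if G.Adj w u then y u else 0) * (x w ^ 2 / y w))]
      ring
    _ ≤ _ := hS

/-- The degree of a vertex is at most the square of the index. -/
theorem degree_le_index_sq (v : V) [Fintype (G.neighborSet v)] :
    (G.degree v : ℝ) ≤ index G ^ 2 := by
  classical
  by_cases hd : G.degree v = 0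
  · rw [hd]; simpa using sq_nonneg _
  have hd' : (0 : ℝ) < G.degree v := by positivity
  set s := Real.sqrt (G.degree v) with hs
  have hs0 : 0 < s := Real.sqrt_pos.mpr hd'
  have hss : s ^ 2 = G.degree v := Real.sq_sqrt hd'.le
  let x : V → ℝ := fun w => if w = v then s else if G.Adj v w then 1 else 0
  have hx0 : ∀ w, 0 ≤ x w := fun w => by
    simp only [x]; split_ifs <;> first | exact hs0.le | norm_num
  have hcard : ∑ w, (if G.Adj v w then (1 : ℝ) else 0) = G.degree v := by
    rw [Finset.sum_boole]
    unfold SimpleGraph.degree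
    congr 2
    ext w
    simp
  have hnorm : ∑ w, x w ^ 2 = 2 * s ^ 2 := by
    have : ∀ w, x w ^ 2 = (if w = v then s ^ 2 else 0) + (if G.Adj v w then (1 : ℝ) else 0) := by
      intro w
      simp only [x]
      by_cases hw : w = v
      · subst hw; simp
      · simp [hw]
    simp only [this, Finset.sum_add_distrib, hcard, ← hss]
    simp
    ring
  have hquad : 2 * s ^ 3 ≤ quad G x := by
    have hrow : ∀ u, (if u = v then s ^ 3 else if G.Adj v u then s else 0) ≤
        ∑ w, if G.Adj u w then x u * x w else 0 := by
      intro u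
      have hnn : ∀ w, 0 ≤ (if G.Adj u w then x u * x w else 0) := fun w => by
        have := mul_nonneg (hx0 u) (hx0 w)
        split_ifs <;> simp [this]
      split_ifs with h1 h2
      · subst h1
        have : ∀ w, (if G.Adj u w then x u * x w else 0) = s * (if G.Adj u w then 1 else 0) := by
          intro w
          by_cases huw : G.Adj u w
          · simp [x, huw, huw.ne']
          · simp [huw]
        simp only [this, ← Finset.mul_sum, hcard, ← hss]
        exact le_of_eq (by ring)
      · refine le_trans ?_ (Finset.single_le_sum (fun w _ => hnn w) (Finset.mem_univ v))
        simp [x, h2.symm, h1, h2]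
      · exact Finset.sum_nonneg fun w _ => hnn w
    refine le_trans (le_of_eq ?_) (Finset.sum_le_sum fun u _ => hrow u)
    have : ∀ u, (if u = v then s ^ 3 else if G.Adj v u then s else 0) =
        (if u = v then s ^ 3 else 0) + s * (if G.Adj v u then (1 : ℝ) else 0) := by
      intro u
      by_cases hu : u = v
      · subst hu; simp
      · simp [hu]
    simp only [this, Finset.sum_add_distrib, ← Finset.mul_sum, hcard, ← hss]
    simp
    ring
  have h1 := hquad.trans (quad_le_index x)
  rw [hnorm] at h1
  have h2 : s ≤ index G := by
    by_contra! hlt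
    have : index G * (2 * s ^ 2) < s * (2 * s ^ 2) := mul_lt_mul_of_pos_right hlt (by positivity)
    nlinarith
  rw [← hss]
  exact pow_le_pow_left₀ hs0.le h2 2

end Spectral

section Tables

instance (n : ℕ) (l : List (ℕ × ℕ)) : DecidableRel (ofEdges n l).Adj := fun a b =>
  inferInstanceAs (Decidable (a ≠ b ∧ (((a : ℕ), (b : ℕ)) ∈ l ∨ ((b : ℕ), (a : ℕ)) ∈ l)))

/-- The numbers of vertices of seven trees of index at most `2`. -/
def smallOrder : Fin 7 → ℕ :=
  ![5, 6, 7, 8, 7, 8, 9]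

/-- The edges of seven trees of index at most `2`, namely `K_{1,4}` and the graphs
`E₆`, `E₇`, `E₈`, `Ẽ₆`, `Ẽ₇`, `Ẽ₈`. -/
def smallEdges : Fin 7 → List (ℕ × ℕ) :=
  ![[(0, 1), (0, 2), (0, 3), (0, 4)],
    [(0, 1), (0, 2), (2, 3), (0, 4), (4, 5)],
    [(0, 1), (0, 2), (2, 3), (0, 4), (4, 5), (5, 6)],
    [(0, 1), (0, 2), (2, 3), (0, 4), (4, 5), (5, 6), (6, 7)],
    [(0, 1), (1, 2), (0, 3), (3, 4), (0, 5), (5, 6)],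
    [(0, 1), (0, 2), (2, 3), (3, 4), (0, 5), (5, 6), (6, 7)],
    [(0, 1), (0, 2), (2, 3), (0, 4), (4, 5), (5, 6), (6, 7), (7, 8)]]

/-- Seven trees of index at most `2`. -/
def smallGraph (s : Fin 7) : SimpleGraph (Fin (smallOrder s)) :=
  ofEdges (smallOrder s) (smallEdges s)

instance (i : Fin 18) : DecidableRel (minimalGraph i).Adj :=
  inferInstanceAs (DecidableRel (ofEdges (minimalOrder i) (minimalEdges i)).Adj)

instance (s : Fin 7) : DecidableRel (smallGraph s).Adj :=
  inferInstanceAs (DecidableRel (ofEdges (smallOrder s) (smallEdges s)).Adj)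

/-- A boolean test whether the list `f` describes a copy of `ofEdges m l'` in `ofEdges n l`. -/
def isCopy (n : ℕ) (l : List (ℕ × ℕ)) (m : ℕ) (l' : List (ℕ × ℕ)) (f : List ℕ) : Bool :=
  f.length == m && decide f.Nodup && f.all (fun a => decide (a < n)) &&
    l'.all fun p => l.contains (f.getD p.1 0, f.getD p.2 0) ||
      l.contains (f.getD p.2 0, f.getD p.1 0)

theorem isContained_of_isCopy {n m : ℕ} {l l' : List (ℕ × ℕ)} {f : List ℕ}
    (h : isCopy n l m l' f = true) : ofEdges m l' ⊑ ofEdges n l := by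
  simp only [isCopy, Bool.and_eq_true, beq_iff_eq, decide_eq_true_eq, List.all_eq_true,
    Bool.or_eq_true, List.contains_iff_mem] at h
  obtain ⟨⟨⟨h1, h2⟩, h3⟩, h4⟩ := h
  have hget : ∀ a : Fin m, ∃ ha : (a : ℕ) < f.length, f.getD a 0 = f[(a : ℕ)] := fun a =>
    ⟨by rw [h1]; exact a.2, List.getD_eq_getElem _ _ _⟩
  let g : Fin m → Fin n := fun a => ⟨f.getD a 0, by
    obtain ⟨ha, hf⟩ := hget a
    rw [hf]
    exact h3 _ (List.getElem_mem ha)⟩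
  have hg : Function.Injective g := fun a b hab => by
    obtain ⟨ha, hfa⟩ := hget a
    obtain ⟨hb, hfb⟩ := hget b
    have : f.getD a 0 = f.getD b 0 := congrArg Fin.val hab
    rw [hfa, hfb] at this
    exact Fin.ext (h2.getElem_inj_iff.mp this)
  refine ⟨⟨⟨g, fun {a b} hab => ⟨hg.ne hab.1, ?_⟩⟩, hg⟩⟩
  rcases hab.2 with h | h
  · exact h4 _ h
  · exact (h4 _ h).symm

/-- Copies of minimal graphs of index greater than `2` in one-edge extensions of the seven small
trees. -/
def smallCopies : Fin 7 → List (Fin 18 × List ℕ) :=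
  ![[(9, [0, 1, 2, 3, 4, 5]), (10, [0, 2, 3, 4, 1, 5]), (10, [0, 1, 3, 4, 2, 5]), (10, [0, 1, 2,
    4, 3, 5]), (10, [0, 1, 2, 3, 4, 5]), (3, [0, 1, 2, 3]), (3, [0, 1, 3, 2]), (3, [0, 1, 4, 2]),
    (3, [0, 2, 3, 1]), (3, [0, 2, 4, 1]), (3, [0, 3, 4, 1])],
    [(10, [0, 1, 2, 6, 4, 5]), (11, [2, 0, 3, 6, 1, 4, 5]), (11, [4, 0, 5, 6, 1, 2, 3]), (3, [0,
    2, 3, 1]), (3, [0, 4, 5, 1]), (3, [0, 1, 2, 4]), (4, [0, 1, 3, 2, 4]), (3, [0, 1, 4, 2]), (4,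
    [0, 1, 5, 4, 2]), (3, [0, 2, 4, 1]), (4, [0, 2, 5, 4, 1]), (4, [0, 2, 3, 4, 1]), (5, [0, 2, 3,
    5, 4, 1])],
    [(10, [0, 1, 2, 7, 4, 5]), (15, [0, 1, 7, 2, 3, 4, 5, 6]), (11, [2, 0, 3, 7, 1, 4, 5]), (11,
    [0, 4, 1, 2, 7, 5, 6]), (12, [5, 4, 0, 6, 7, 1, 2, 3]), (3, [0, 2, 3, 1]), (3, [0, 4, 5, 1]),
    (4, [0, 4, 5, 6, 1]), (3, [0, 1, 2, 4]), (4, [0, 1, 3, 2, 4]), (3, [0, 1, 4, 2]), (4, [0, 1,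
    5, 4, 2]), (5, [0, 1, 6, 5, 4, 2]), (3, [0, 2, 4, 1]), (4, [0, 2, 5, 4, 1]), (5, [0, 2, 6, 5,
    4, 1]), (4, [0, 2, 3, 4, 1]), (5, [0, 2, 3, 5, 4, 1]), (6, [0, 2, 3, 6, 5, 4, 1]), (3, [4, 5,
    6, 0])],
    [(10, [0, 1, 2, 8, 4, 5]), (15, [0, 1, 8, 2, 3, 4, 5, 6]), (11, [2, 0, 3, 8, 1, 4, 5]), (16,
    [0, 1, 2, 3, 8, 4, 5, 6, 7]), (11, [0, 4, 1, 2, 8, 5, 6]), (12, [0, 4, 5, 1, 2, 8, 6, 7]),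
    (13, [6, 5, 4, 0, 7, 8, 1, 2, 3]), (3, [0, 2, 3, 1]), (3, [0, 4, 5, 1]), (4, [0, 4, 5, 6, 1]),
    (5, [0, 4, 5, 6, 7, 1]), (3, [0, 1, 2, 4]), (4, [0, 1, 3, 2, 4]), (3, [0, 1, 4, 2]), (4, [0,
    1, 5, 4, 2]), (5, [0, 1, 6, 5, 4, 2]), (6, [0, 1, 7, 6, 5, 4, 2]), (3, [0, 2, 4, 1]), (4, [0,
    2, 5, 4, 1]), (5, [0, 2, 6, 5, 4, 1]), (6, [0, 2, 7, 6, 5, 4, 1]), (4, [0, 2, 3, 4, 1]), (5,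
    [0, 2, 3, 5, 4, 1]), (6, [0, 2, 3, 6, 5, 4, 1]), (7, [0, 2, 3, 7, 6, 5, 4, 1]), (3, [4, 5, 6,
    0]), (4, [4, 5, 6, 7, 0]), (3, [5, 6, 7, 4])],
    [(10, [0, 1, 3, 7, 5, 6]), (11, [1, 0, 2, 7, 3, 5, 6]), (15, [0, 3, 4, 5, 6, 1, 2, 7]), (11,
    [3, 0, 4, 7, 1, 5, 6]), (15, [0, 1, 2, 5, 6, 3, 4, 7]), (11, [5, 0, 6, 7, 1, 3, 4]), (15, [0,
    1, 2, 3, 4, 5, 6, 7]), (3, [0, 1, 2, 3]), (3, [0, 3, 4, 1]), (3, [0, 5, 6, 1]), (3, [0, 1, 3,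
    5]), (4, [0, 1, 4, 3, 5]), (3, [0, 1, 5, 3]), (4, [0, 1, 6, 5, 3]), (4, [0, 1, 2, 3, 5]), (5,
    [0, 1, 2, 4, 3, 5]), (4, [0, 1, 2, 5, 3]), (5, [0, 1, 2, 6, 5, 3]), (3, [0, 3, 5, 1]), (4, [0,
    3, 6, 5, 1]), (4, [0, 3, 4, 5, 1]), (5, [0, 3, 4, 6, 5, 1])],
    [(10, [0, 1, 2, 8, 5, 6]), (15, [0, 1, 8, 2, 3, 5, 6, 7]), (11, [0, 2, 1, 5, 8, 3, 4]), (12,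
    [3, 2, 0, 4, 8, 1, 5, 6]), (16, [0, 1, 5, 6, 7, 2, 3, 4, 8]), (11, [0, 5, 1, 2, 8, 6, 7]),
    (12, [6, 5, 0, 7, 8, 1, 2, 3]), (16, [0, 1, 2, 3, 4, 5, 6, 7, 8]), (3, [0, 2, 3, 1]), (4, [0,
    2, 3, 4, 1]), (3, [0, 5, 6, 1]), (4, [0, 5, 6, 7, 1]), (3, [0, 1, 2, 5]), (4, [0, 1, 3, 2,
    5]), (5, [0, 1, 4, 3, 2, 5]), (3, [0, 1, 5, 2]), (4, [0, 1, 6, 5, 2]), (5, [0, 1, 7, 6, 5,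
    2]), (3, [2, 3, 4, 0]), (3, [0, 2, 5, 1]), (4, [0, 2, 6, 5, 1]), (5, [0, 2, 7, 6, 5, 1]), (4,
    [0, 2, 3, 5, 1]), (5, [0, 2, 3, 6, 5, 1]), (6, [0, 2, 3, 7, 6, 5, 1]), (5, [0, 2, 3, 4, 5,
    1]), (6, [0, 2, 3, 4, 6, 5, 1]), (7, [0, 2, 3, 4, 7, 6, 5, 1]), (3, [5, 6, 7, 0])],
    [(10, [0, 1, 2, 9, 4, 5]), (15, [0, 1, 9, 2, 3, 4, 5, 6]), (11, [2, 0, 3, 9, 1, 4, 5]), (16,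
    [0, 1, 2, 3, 9, 4, 5, 6, 7]), (11, [0, 4, 1, 2, 9, 5, 6]), (12, [0, 4, 5, 1, 2, 9, 6, 7]),
    (13, [0, 4, 5, 6, 1, 2, 9, 7, 8]), (14, [7, 6, 5, 4, 0, 8, 9, 1, 2, 3]), (17, [0, 1, 2, 3, 4,
    5, 6, 7, 8, 9]), (3, [0, 2, 3, 1]), (3, [0, 4, 5, 1]), (4, [0, 4, 5, 6, 1]), (5, [0, 4, 5, 6,
    7, 1]), (6, [0, 4, 5, 6, 7, 8, 1]), (3, [0, 1, 2, 4]), (4, [0, 1, 3, 2, 4]), (3, [0, 1, 4,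
    2]), (4, [0, 1, 5, 4, 2]), (5, [0, 1, 6, 5, 4, 2]), (6, [0, 1, 7, 6, 5, 4, 2]), (7, [0, 1, 8,
    7, 6, 5, 4, 2]), (3, [0, 2, 4, 1]), (4, [0, 2, 5, 4, 1]), (5, [0, 2, 6, 5, 4, 1]), (6, [0, 2,
    7, 6, 5, 4, 1]), (7, [0, 2, 8, 7, 6, 5, 4, 1]), (4, [0, 2, 3, 4, 1]), (5, [0, 2, 3, 5, 4, 1]),
    (6, [0, 2, 3, 6, 5, 4, 1]), (7, [0, 2, 3, 7, 6, 5, 4, 1]), (8, [0, 2, 3, 8, 7, 6, 5, 4, 1]),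
    (3, [4, 5, 6, 0]), (4, [4, 5, 6, 7, 0]), (5, [4, 5, 6, 7, 8, 0]), (3, [5, 6, 7, 4]), (4, [5,
    6, 7, 8, 4]), (3, [6, 7, 8, 5])]]

/-- Copies of small trees in extensions of small trees by a pendant edge. -/
def smallGrowth : Fin 7 → List (Fin 7 × List ℕ) :=
  ![[],
    [(4, [0, 1, 6, 2, 3, 4, 5]), (2, [0, 1, 4, 5, 2, 3, 6]), (2, [0, 1, 2, 3, 4, 5, 6])],
    [(5, [0, 1, 2, 3, 7, 4, 5, 6]), (3, [0, 1, 2, 3, 4, 5, 6, 7])],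
    [(6, [0, 1, 2, 3, 4, 5, 6, 7, 8])],
    [],
    [],
    []]

theorem small_pendant_check : ∀ s : Fin 7, ∀ i : Fin (smallOrder s),
    ((smallCopies s).any fun r => isCopy (smallOrder s + 1) ((i.1, smallOrder s) :: smallEdges s)
      (minimalOrder r.1) (minimalEdges r.1) r.2) = true ∨
    ((smallGrowth s).any fun r => decide (s < r.1) &&
      isCopy (smallOrder s + 1) ((i.1, smallOrder s) :: smallEdges s)
        (smallOrder r.1) (smallEdges r.1) r.2) = true := by
  decide +kernel

theorem small_edge_check : ∀ s : Fin 7, ∀ a b : Fin (smallOrder s), a ≠ b →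
    ¬ (smallGraph s).Adj a b →
    ((smallCopies s).any fun r => isCopy (smallOrder s) ((a.1, b.1) :: smallEdges s)
      (minimalOrder r.1) (minimalEdges r.1) r.2) = true := by
  decide +kernel

/-- A copy of a minimal graph of index greater than `2` in each graph which is obtained from
another such graph by adding an edge. -/
def minimalCopies : Fin 18 → List (Fin 18 × List ℕ) :=
  ![[],
    [(0, [0, 1, 2, 3])],
    [(1, [0, 1, 2, 3]), (1, [2, 3, 0, 1]), (1, [2, 4, 0, 1]), (1, [3, 4, 0, 1])],
    [(1, [0, 1, 2, 3]), (1, [0, 2, 1, 3])],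
    [(1, [0, 2, 1, 3]), (1, [1, 3, 0, 2]), (3, [0, 1, 4, 3]), (2, [0, 2, 1, 3, 4]), (3, [0, 3, 4,
    1])],
    [(3, [0, 1, 2, 4]), (3, [0, 3, 4, 1]), (3, [1, 2, 3, 0]), (3, [0, 1, 4, 5]), (3, [0, 1, 5,
    4]), (3, [2, 3, 4, 1]), (4, [0, 1, 2, 5, 4]), (4, [0, 4, 3, 5, 1]), (3, [0, 4, 5, 1])],
    [(3, [0, 1, 2, 5]), (4, [0, 1, 2, 3, 5]), (3, [0, 4, 5, 1]), (3, [1, 2, 3, 0]), (4, [0, 1, 4,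
    5, 6]), (3, [0, 1, 5, 6]), (3, [0, 1, 6, 5]), (3, [2, 3, 4, 1]), (4, [0, 1, 2, 5, 6]), (4, [0,
    1, 2, 6, 5]), (3, [3, 4, 5, 2]), (5, [0, 1, 2, 3, 6, 5]), (4, [0, 5, 4, 6, 1]), (3, [0, 5, 6,
    1])],
    [(3, [0, 1, 2, 6]), (4, [0, 1, 2, 3, 6]), (4, [0, 4, 5, 6, 1]), (3, [0, 5, 6, 1]), (3, [1, 2,
    3, 0]), (4, [1, 2, 3, 4, 0]), (4, [0, 1, 5, 6, 7]), (3, [0, 1, 6, 7]), (3, [0, 1, 7, 6]), (3,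
    [2, 3, 4, 1]), (4, [2, 3, 4, 5, 1]), (4, [0, 1, 2, 6, 7]), (4, [0, 1, 2, 7, 6]), (3, [3, 4, 5,
    2]), (4, [3, 4, 5, 6, 2]), (5, [0, 1, 2, 3, 7, 6]), (3, [4, 5, 6, 3]), (5, [0, 6, 5, 4, 7,
    1]), (4, [0, 6, 5, 7, 1]), (3, [0, 6, 7, 1])],
    [(3, [0, 1, 2, 7]), (4, [0, 1, 2, 3, 7]), (5, [0, 1, 2, 3, 4, 7]), (4, [0, 5, 6, 7, 1]), (3,
    [0, 6, 7, 1]), (3, [1, 2, 3, 0]), (4, [1, 2, 3, 4, 0]), (5, [0, 1, 5, 6, 7, 8]), (4, [0, 1, 6,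
    7, 8]), (3, [0, 1, 7, 8]), (3, [0, 1, 8, 7]), (3, [2, 3, 4, 1]), (4, [2, 3, 4, 5, 1]), (5, [0,
    1, 2, 6, 7, 8]), (4, [0, 1, 2, 7, 8]), (4, [0, 1, 2, 8, 7]), (3, [3, 4, 5, 2]), (4, [3, 4, 5,
    6, 2]), (5, [0, 1, 2, 3, 7, 8]), (5, [0, 1, 2, 3, 8, 7]), (3, [4, 5, 6, 3]), (4, [4, 5, 6, 7,
    3]), (6, [0, 1, 2, 3, 4, 8, 7]), (3, [5, 6, 7, 4]), (5, [0, 7, 6, 5, 8, 1]), (4, [0, 7, 6, 8,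
    1]), (3, [0, 7, 8, 1])],
    [(3, [0, 1, 2, 3]), (3, [0, 1, 3, 2]), (3, [0, 1, 4, 2]), (3, [0, 1, 5, 2]), (3, [0, 2, 3,
    1]), (3, [0, 2, 4, 1]), (3, [0, 2, 5, 1]), (3, [0, 3, 4, 1]), (3, [0, 3, 5, 1]), (3, [0, 4, 5,
    1])],
    [(3, [0, 4, 5, 1]), (3, [0, 1, 2, 3]), (3, [0, 1, 3, 2]), (3, [0, 1, 4, 2]), (4, [0, 1, 5, 4,
    2]), (3, [0, 2, 3, 1]), (3, [0, 2, 4, 1]), (4, [0, 2, 5, 4, 1]), (3, [0, 3, 4, 1]), (4, [0, 3,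
    5, 4, 1])],
    [(3, [0, 1, 4, 2]), (3, [0, 1, 5, 2]), (4, [0, 1, 5, 6, 2]), (3, [0, 1, 2, 3]), (3, [0, 1, 3,
    2]), (3, [1, 5, 6, 0]), (3, [0, 2, 3, 1]), (4, [0, 1, 4, 2, 3]), (4, [0, 1, 5, 2, 3]), (5, [0,
    1, 5, 6, 2, 3]), (4, [0, 1, 4, 3, 2]), (4, [0, 1, 5, 3, 2]), (5, [0, 1, 5, 6, 3, 2]), (3, [1,
    4, 5, 0]), (4, [1, 4, 6, 5, 0])],
    [(3, [0, 1, 2, 3]), (4, [0, 1, 2, 5, 3]), (4, [0, 1, 2, 6, 3]), (5, [0, 1, 2, 6, 7, 3]), (3,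
    [0, 1, 3, 4]), (3, [0, 1, 4, 3]), (3, [1, 2, 5, 0]), (3, [1, 2, 6, 0]), (4, [1, 2, 6, 7, 0]),
    (4, [0, 1, 2, 3, 4]), (4, [0, 1, 2, 4, 3]), (3, [2, 6, 7, 1]), (3, [0, 3, 4, 1]), (5, [0, 1,
    2, 5, 3, 4]), (5, [0, 1, 2, 6, 3, 4]), (6, [0, 1, 2, 6, 7, 3, 4]), (5, [0, 1, 2, 5, 4, 3]),
    (5, [0, 1, 2, 6, 4, 3]), (6, [0, 1, 2, 6, 7, 4, 3]), (3, [2, 5, 6, 1]), (4, [2, 5, 7, 6, 1])],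
    [(3, [0, 1, 2, 4]), (4, [0, 1, 2, 3, 4]), (5, [0, 1, 2, 3, 6, 4]), (5, [0, 1, 2, 3, 7, 4]),
    (6, [0, 1, 2, 3, 7, 8, 4]), (3, [1, 2, 3, 0]), (3, [0, 1, 4, 5]), (3, [0, 1, 5, 4]), (4, [1,
    2, 3, 6, 0]), (4, [1, 2, 3, 7, 0]), (5, [1, 2, 3, 7, 8, 0]), (4, [0, 1, 2, 4, 5]), (4, [0, 1,
    2, 5, 4]), (3, [2, 3, 6, 1]), (3, [2, 3, 7, 1]), (4, [2, 3, 7, 8, 1]), (5, [0, 1, 2, 3, 4,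
    5]), (5, [0, 1, 2, 3, 5, 4]), (3, [3, 7, 8, 2]), (3, [0, 4, 5, 1]), (6, [0, 1, 2, 3, 6, 4,
    5]), (6, [0, 1, 2, 3, 7, 4, 5]), (7, [0, 1, 2, 3, 7, 8, 4, 5]), (6, [0, 1, 2, 3, 6, 5, 4]),
    (6, [0, 1, 2, 3, 7, 5, 4]), (7, [0, 1, 2, 3, 7, 8, 5, 4]), (3, [3, 6, 7, 2]), (4, [3, 6, 8, 7,
    2])],
    [(3, [0, 1, 2, 5]), (4, [0, 1, 2, 3, 5]), (5, [0, 1, 2, 3, 4, 5]), (6, [0, 1, 2, 3, 4, 7, 5]),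
    (6, [0, 1, 2, 3, 4, 8, 5]), (7, [0, 1, 2, 3, 4, 8, 9, 5]), (3, [1, 2, 3, 0]), (4, [1, 2, 3, 4,
    0]), (3, [0, 1, 5, 6]), (3, [0, 1, 6, 5]), (5, [1, 2, 3, 4, 7, 0]), (5, [1, 2, 3, 4, 8, 0]),
    (6, [1, 2, 3, 4, 8, 9, 0]), (3, [2, 3, 4, 1]), (4, [0, 1, 2, 5, 6]), (4, [0, 1, 2, 6, 5]), (4,
    [2, 3, 4, 7, 1]), (4, [2, 3, 4, 8, 1]), (5, [2, 3, 4, 8, 9, 1]), (5, [0, 1, 2, 3, 5, 6]), (5,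
    [0, 1, 2, 3, 6, 5]), (3, [3, 4, 7, 2]), (3, [3, 4, 8, 2]), (4, [3, 4, 8, 9, 2]), (6, [0, 1, 2,
    3, 4, 5, 6]), (6, [0, 1, 2, 3, 4, 6, 5]), (3, [4, 8, 9, 3]), (3, [0, 5, 6, 1]), (7, [0, 1, 2,
    3, 4, 7, 5, 6]), (7, [0, 1, 2, 3, 4, 8, 5, 6]), (8, [0, 1, 2, 3, 4, 8, 9, 5, 6]), (7, [0, 1,
    2, 3, 4, 7, 6, 5]), (7, [0, 1, 2, 3, 4, 8, 6, 5]), (8, [0, 1, 2, 3, 4, 8, 9, 6, 5]), (3, [4,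
    7, 8, 3]), (4, [4, 7, 9, 8, 3])],
    [(3, [0, 1, 2, 3]), (3, [0, 3, 4, 1]), (3, [0, 5, 6, 1]), (4, [0, 5, 6, 7, 1]), (3, [0, 1, 3,
    5]), (4, [0, 1, 4, 3, 5]), (3, [0, 1, 5, 3]), (4, [0, 1, 6, 5, 3]), (5, [0, 1, 7, 6, 5, 3]),
    (4, [0, 1, 2, 3, 5]), (5, [0, 1, 2, 4, 3, 5]), (4, [0, 1, 2, 5, 3]), (5, [0, 1, 2, 6, 5, 3]),
    (6, [0, 1, 2, 7, 6, 5, 3]), (3, [0, 3, 5, 1]), (4, [0, 3, 6, 5, 1]), (5, [0, 3, 7, 6, 5, 1]),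
    (4, [0, 3, 4, 5, 1]), (5, [0, 3, 4, 6, 5, 1]), (6, [0, 3, 4, 7, 6, 5, 1]), (3, [5, 6, 7, 0])],
    [(3, [0, 2, 3, 1]), (4, [0, 2, 3, 4, 1]), (3, [0, 5, 6, 1]), (4, [0, 5, 6, 7, 1]), (5, [0, 5,
    6, 7, 8, 1]), (3, [0, 1, 2, 5]), (4, [0, 1, 3, 2, 5]), (5, [0, 1, 4, 3, 2, 5]), (3, [0, 1, 5,
    2]), (4, [0, 1, 6, 5, 2]), (5, [0, 1, 7, 6, 5, 2]), (6, [0, 1, 8, 7, 6, 5, 2]), (3, [2, 3, 4,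
    0]), (3, [0, 2, 5, 1]), (4, [0, 2, 6, 5, 1]), (5, [0, 2, 7, 6, 5, 1]), (6, [0, 2, 8, 7, 6, 5,
    1]), (4, [0, 2, 3, 5, 1]), (5, [0, 2, 3, 6, 5, 1]), (6, [0, 2, 3, 7, 6, 5, 1]), (7, [0, 2, 3,
    8, 7, 6, 5, 1]), (5, [0, 2, 3, 4, 5, 1]), (6, [0, 2, 3, 4, 6, 5, 1]), (7, [0, 2, 3, 4, 7, 6,
    5, 1]), (8, [0, 2, 3, 4, 8, 7, 6, 5, 1]), (3, [5, 6, 7, 0]), (4, [5, 6, 7, 8, 0]), (3, [6, 7,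
    8, 5])],
    [(3, [0, 2, 3, 1]), (3, [0, 4, 5, 1]), (4, [0, 4, 5, 6, 1]), (5, [0, 4, 5, 6, 7, 1]), (6, [0,
    4, 5, 6, 7, 8, 1]), (7, [0, 4, 5, 6, 7, 8, 9, 1]), (3, [0, 1, 2, 4]), (4, [0, 1, 3, 2, 4]),
    (3, [0, 1, 4, 2]), (4, [0, 1, 5, 4, 2]), (5, [0, 1, 6, 5, 4, 2]), (6, [0, 1, 7, 6, 5, 4, 2]),
    (7, [0, 1, 8, 7, 6, 5, 4, 2]), (8, [0, 1, 9, 8, 7, 6, 5, 4, 2]), (3, [0, 2, 4, 1]), (4, [0, 2,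
    5, 4, 1]), (5, [0, 2, 6, 5, 4, 1]), (6, [0, 2, 7, 6, 5, 4, 1]), (7, [0, 2, 8, 7, 6, 5, 4, 1]),
    (8, [0, 2, 9, 8, 7, 6, 5, 4, 1]), (4, [0, 2, 3, 4, 1]), (5, [0, 2, 3, 5, 4, 1]), (6, [0, 2, 3,
    6, 5, 4, 1]), (7, [0, 2, 3, 7, 6, 5, 4, 1]), (8, [0, 2, 3, 8, 7, 6, 5, 4, 1]), (16, [0, 1, 2,
    3, 9, 4, 5, 6, 7]), (3, [4, 5, 6, 0]), (4, [4, 5, 6, 7, 0]), (5, [4, 5, 6, 7, 8, 0]), (6, [4,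
    5, 6, 7, 8, 9, 0]), (3, [5, 6, 7, 4]), (4, [5, 6, 7, 8, 4]), (5, [5, 6, 7, 8, 9, 4]), (3, [6,
    7, 8, 5]), (4, [6, 7, 8, 9, 5]), (3, [7, 8, 9, 6])]]

theorem minimal_edge_check : ∀ i : Fin 18, ∀ a b : Fin (minimalOrder i), a ≠ b →
    ¬ (minimalGraph i).Adj a b →
    ((minimalCopies i).any fun r => decide (minimalOrder r.1 < minimalOrder i ∨
        minimalOrder r.1 = minimalOrder i ∧
          (minimalEdges i).length < (minimalEdges r.1).length) &&
      isCopy (minimalOrder i) ((a.1, b.1) :: minimalEdges i)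
        (minimalOrder r.1) (minimalEdges r.1) r.2) = true := by
  decide +kernel

/-- Vectors certifying that an index is greater than `2`. -/
def minimalTest : Fin 18 → List ℕ :=
  ![[1, 1, 1, 1],
    [1, 1, 1, 1],
    [1, 1, 1, 1, 1],
    [2, 2, 2, 1],
    [2, 2, 2, 2, 1],
    [3, 2, 2, 2, 2, 1],
    [3, 2, 2, 2, 2, 2, 1],
    [3, 2, 2, 2, 2, 2, 2, 1],
    [3, 2, 2, 2, 2, 2, 2, 2, 1],
    [2, 1, 1, 1, 1, 1],
    [4, 2, 2, 2, 3, 1],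
    [4, 4, 2, 2, 2, 3, 1],
    [4, 5, 5, 2, 2, 2, 3, 2],
    [4, 4, 4, 5, 2, 2, 2, 3, 2],
    [4, 4, 4, 4, 5, 2, 2, 2, 3, 2],
    [6, 4, 2, 4, 2, 4, 3, 1],
    [8, 4, 6, 4, 2, 6, 5, 3, 2],
    [12, 6, 8, 4, 10, 8, 7, 5, 3, 2]]

theorem minimalTest_check : ∀ i : Fin 18,
    2 * ∑ u : Fin (minimalOrder i), (minimalTest i).getD u.1 0 ^ 2 <
      ∑ u : Fin (minimalOrder i), ∑ w : Fin (minimalOrder i),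
        if (minimalGraph i).Adj u w then
          (minimalTest i).getD u.1 0 * (minimalTest i).getD w.1 0 else 0 := by
  decide +kernel

/-- Positive vectors `y` with `A y ≤ 2 y` for the vertex-deleted subgraphs of the minimal graphs
of index greater than `2`. -/
def minimalHarmonic : Fin 18 → List (List ℕ) :=
  ![[[0, 1, 1, 1], [1, 0, 1, 1], [1, 1, 0, 1], [1, 1, 1, 0]],
    [[0, 1, 1, 1], [1, 0, 1, 1], [1, 1, 0, 1], [1, 1, 1, 0]],
    [[0, 2, 1, 1, 1], [2, 0, 1, 1, 1], [1, 1, 0, 1, 1], [1, 1, 1, 0, 1], [1, 1, 1, 1, 0]],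
    [[0, 1, 1, 1], [1, 0, 1, 1], [1, 1, 0, 1], [1, 1, 1, 0]],
    [[0, 1, 1, 1, 1], [1, 0, 1, 1, 1], [2, 1, 0, 1, 1], [1, 1, 1, 0, 1], [1, 1, 1, 1, 0]],
    [[0, 1, 1, 1, 1, 1], [1, 0, 1, 1, 1, 1], [2, 1, 0, 2, 2, 1], [2, 2, 1, 0, 1, 1], [1, 1, 1, 1,
    0, 1], [1, 1, 1, 1, 1, 0]],
    [[0, 1, 1, 1, 1, 1, 1], [1, 0, 1, 1, 1, 1, 1], [2, 1, 0, 2, 2, 2, 1], [3, 2, 1, 0, 1, 2, 2],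
    [2, 2, 2, 1, 0, 1, 1], [1, 1, 1, 1, 1, 0, 1], [1, 1, 1, 1, 1, 1, 0]],
    [[0, 1, 1, 1, 1, 1, 1, 1], [1, 0, 1, 1, 1, 1, 1, 1], [2, 1, 0, 2, 2, 2, 2, 1], [4, 3, 2, 0, 1,
    2, 3, 2], [4, 3, 2, 1, 0, 2, 3, 2], [2, 2, 2, 2, 1, 0, 1, 1], [1, 1, 1, 1, 1, 1, 0, 1], [1, 1,
    1, 1, 1, 1, 1, 0]],
    [[0, 1, 1, 1, 1, 1, 1, 1, 1], [1, 0, 1, 1, 1, 1, 1, 1, 1], [2, 1, 0, 2, 2, 2, 2, 2, 1], [6, 4,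
    2, 0, 2, 3, 4, 5, 3], [4, 3, 2, 1, 0, 1, 2, 3, 2], [6, 5, 4, 3, 2, 0, 2, 4, 3], [2, 2, 2, 2,
    2, 1, 0, 1, 1], [1, 1, 1, 1, 1, 1, 1, 0, 1], [1, 1, 1, 1, 1, 1, 1, 1, 0]],
    [[0, 1, 1, 1, 1, 1], [2, 0, 1, 1, 1, 1], [2, 1, 0, 1, 1, 1], [2, 1, 1, 0, 1, 1], [2, 1, 1, 1,
    0, 1], [2, 1, 1, 1, 1, 0]],
    [[0, 1, 1, 1, 1, 1], [2, 0, 1, 1, 2, 1], [2, 1, 0, 1, 2, 1], [2, 1, 1, 0, 2, 1], [2, 1, 1, 1,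
    0, 1], [2, 1, 1, 1, 1, 0]],
    [[0, 1, 1, 1, 1, 1, 1], [1, 0, 1, 1, 1, 1, 1], [2, 3, 0, 1, 2, 2, 1], [2, 3, 1, 0, 2, 2, 1],
    [2, 2, 1, 1, 0, 2, 1], [2, 2, 1, 1, 1, 0, 1], [2, 2, 1, 1, 1, 1, 0]],
    [[0, 1, 2, 1, 1, 1, 2, 1], [1, 0, 1, 1, 1, 1, 1, 1], [2, 1, 0, 1, 1, 1, 1, 1], [2, 3, 4, 0, 1,
    2, 3, 2], [2, 3, 4, 1, 0, 2, 3, 2], [2, 2, 2, 1, 1, 0, 2, 1], [2, 2, 2, 1, 1, 1, 0, 1], [2, 2,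
    2, 1, 1, 1, 1, 0]],
    [[0, 1, 2, 3, 1, 1, 2, 2, 1], [1, 0, 1, 2, 1, 1, 1, 2, 1], [2, 1, 0, 1, 1, 1, 1, 1, 1], [2, 2,
    1, 0, 1, 1, 1, 1, 1], [3, 4, 5, 6, 0, 2, 3, 4, 2], [3, 4, 5, 6, 2, 0, 3, 4, 2], [2, 2, 2, 2,
    1, 1, 0, 2, 1], [2, 2, 2, 2, 1, 1, 1, 0, 1], [2, 2, 2, 2, 1, 1, 1, 1, 0]],
    [[0, 1, 2, 3, 4, 1, 1, 2, 3, 2], [1, 0, 1, 2, 3, 1, 1, 2, 2, 1], [2, 1, 0, 1, 2, 1, 1, 1, 2,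
    1], [2, 2, 1, 0, 1, 1, 1, 1, 1, 1], [2, 2, 2, 1, 0, 1, 1, 1, 1, 1], [2, 3, 4, 5, 6, 0, 1, 3,
    4, 2], [2, 3, 4, 5, 6, 1, 0, 3, 4, 2], [2, 2, 2, 2, 2, 1, 1, 0, 2, 1], [2, 2, 2, 2, 2, 1, 1,
    1, 0, 1], [2, 2, 2, 2, 2, 1, 1, 1, 1, 0]],
    [[0, 1, 1, 1, 1, 1, 1, 1], [1, 0, 1, 1, 1, 1, 1, 1], [4, 2, 0, 3, 2, 3, 2, 1], [1, 1, 1, 0, 1,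
    1, 1, 1], [4, 3, 2, 2, 0, 3, 2, 1], [1, 1, 1, 1, 1, 0, 1, 1], [3, 2, 1, 2, 1, 2, 0, 1], [3, 2,
    1, 2, 1, 2, 1, 0]],
    [[0, 1, 1, 1, 1, 1, 1, 1, 1], [1, 0, 1, 1, 1, 1, 1, 1, 1], [1, 1, 0, 1, 1, 1, 1, 1, 1], [2, 1,
    1, 0, 1, 2, 2, 2, 1], [6, 3, 4, 2, 0, 5, 4, 3, 2], [1, 1, 1, 1, 1, 0, 1, 1, 1], [2, 1, 2, 2,
    1, 1, 0, 1, 1], [4, 2, 3, 2, 1, 3, 2, 0, 1], [4, 2, 3, 2, 1, 3, 2, 1, 0]],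
    [[0, 1, 1, 1, 1, 1, 1, 1, 1, 1], [1, 0, 1, 1, 1, 1, 1, 1, 1, 1], [1, 1, 0, 1, 1, 1, 1, 1, 1,
    1], [2, 1, 1, 0, 2, 2, 2, 2, 2, 1], [1, 1, 1, 1, 0, 1, 1, 1, 1, 1], [2, 1, 2, 1, 1, 0, 1, 1,
    1, 1], [3, 2, 2, 1, 2, 1, 0, 1, 1, 1], [4, 2, 3, 2, 3, 2, 1, 0, 1, 1], [6, 3, 4, 2, 5, 4, 3,
    2, 0, 1], [6, 3, 4, 2, 5, 4, 3, 2, 1, 0]]]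

theorem minimalHarmonic_check : ∀ i : Fin 18, ∀ v u : Fin (minimalOrder i), u ≠ v →
    0 < ((minimalHarmonic i).getD v.1 []).getD u.1 0 ∧
    (∑ w : Fin (minimalOrder i), if (minimalGraph i).Adj u w ∧ w ≠ v then
      ((minimalHarmonic i).getD v.1 []).getD w.1 0 else 0) ≤
      2 * ((minimalHarmonic i).getD v.1 []).getD u.1 0 := by
  decide +kernel

/-- Positive vectors `y` with `A y ≤ 2 y` for the seven small trees. -/
def smallHarmonic : Fin 7 → List ℕ :=
  ![[2, 1, 1, 1, 1],
    [6, 3, 4, 2, 4, 2],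
    [6, 3, 4, 2, 5, 4, 3],
    [6, 3, 4, 2, 5, 4, 3, 2],
    [3, 2, 1, 2, 1, 2, 1],
    [4, 2, 3, 2, 1, 3, 2, 1],
    [6, 3, 4, 2, 5, 4, 3, 2, 1]]

theorem smallHarmonic_check : ∀ s : Fin 7, ∀ u : Fin (smallOrder s),
    0 < (smallHarmonic s).getD u.1 0 ∧
    (∑ w : Fin (smallOrder s), if (smallGraph s).Adj u w then
      (smallHarmonic s).getD w.1 0 else 0) ≤ 2 * (smallHarmonic s).getD u.1 0 := by
  decide +kernel

theorem minimal_invariant_check : ∀ i j : Fin 18, i ≠ j → minimalOrder i = minimalOrder j →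
    ∑ u : Fin (minimalOrder i), (∑ w, if (minimalGraph i).Adj u w then 1 else 0) ^ 2 ≠
    ∑ u : Fin (minimalOrder j), (∑ w, if (minimalGraph j).Adj u w then 1 else 0) ^ 2 := by
  decide +kernel

theorem small_degree_check : ∀ s : Fin 7, ∀ u : Fin (smallOrder s), u.1 ≠ 0 →
    (∑ w, if (smallGraph s).Adj u w then 1 else 0) ≤ 2 := by
  decide +kernel

end Tables

section Classification

theorem isContained_of_list {V : Type*} {K : SimpleGraph V} {n : ℕ} {l : List (ℕ × ℕ)}
    (vs : List V) (r : V) (hn : vs.length = n) (hvs : vs.Nodup)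
    (h : ∀ p ∈ l, K.Adj (vs.getD p.1 r) (vs.getD p.2 r)) : ofEdges n l ⊑ K := by
  have hg : Function.Injective fun a : Fin n => vs.getD a.1 r := fun a b hab => by
    have ha : a.1 < vs.length := by rw [hn]; exact a.2
    have hb : b.1 < vs.length := by rw [hn]; exact b.2
    simp only [List.getD_eq_getElem _ _ ha, List.getD_eq_getElem _ _ hb] at hab
    exact Fin.ext (hvs.getElem_inj_iff.mp hab)
  refine ⟨⟨⟨fun a => vs.getD a.1 r, fun {a b} hab => ?_⟩, hg⟩⟩
  rcases hab.2 with h1 | h1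
  · exact h _ h1
  · exact (h _ h1).symm

theorem ofEdges_cons_isContained {V : Type*} {K : SimpleGraph V} {n : ℕ} {l : List (ℕ × ℕ)}
    (f : Copy (ofEdges n l) K) {a b : Fin n} (h : K.Adj (f a) (f b)) :
    ofEdges n ((a.1, b.1) :: l) ⊑ K := by
  refine ⟨⟨⟨f, fun {c d} hcd => ?_⟩, f.injective⟩⟩
  obtain ⟨hne, hcd⟩ := hcd
  simp only [List.mem_cons, Prod.mk.injEq, Fin.val_inj] at hcd
  rcases hcd with (⟨rfl, rfl⟩ | h1) | (⟨rfl, rfl⟩ | h1)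
  · exact h
  · exact f.toHom.map_adj ⟨hne, Or.inl h1⟩
  · exact h.symm
  · exact f.toHom.map_adj ⟨hne, Or.inr h1⟩

theorem ofEdges_pendant_isContained {V : Type*} {K : SimpleGraph V} {n : ℕ} {l : List (ℕ × ℕ)}
    (hl : ∀ p ∈ l, p.1 < n ∧ p.2 < n) (f : Copy (ofEdges n l) K) {a : Fin n} {w : V}
    (hw : w ∉ Set.range f) (h : K.Adj (f a) w) :
    ofEdges (n + 1) ((a.1, n) :: l) ⊑ K := by
  have hf : Function.Injective f := f.injective
  let g : Fin (n + 1) → V := fun c => if hc : c.1 < n then f ⟨c, hc⟩ else w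
  have hg : Function.Injective g := fun c d hcd => by
    simp only [g] at hcd
    split_ifs at hcd with h1 h2 h2
    · exact Fin.ext (Fin.mk.inj (hf hcd))
    · exact absurd ⟨_, hcd⟩ hw
    · exact absurd ⟨_, hcd.symm⟩ hw
    · exact Fin.ext (by omega)
  have key : ∀ c d : Fin (n + 1), c ≠ d → (c.1, d.1) ∈ (a.1, n) :: l → K.Adj (g c) (g d) := by
    intro c d hne hcd
    simp only [List.mem_cons, Prod.mk.injEq] at hcd
    rcases hcd with ⟨h1, h2⟩ | h1
    · have e1 : g c = f a := by
        simp only [g, h1, a.2, dif_pos]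
      have e2 : g d = w := by simp [g, h2]
      rw [e1, e2]
      exact h
    · obtain ⟨h2, h3⟩ := hl _ h1
      simp only at h2 h3
      simp only [g, h2, h3, dif_pos]
      exact f.toHom.map_adj ⟨fun e => hne (Fin.ext (Fin.mk.inj e)), Or.inl h1⟩
  refine ⟨⟨⟨g, fun {c d} hcd => ?_⟩, hg⟩⟩
  rcases hcd.2 with h1 | h1
  · exact key c d hcd.1 h1
  · exact (key d c hcd.1.symm h1).symm

theorem exists_adj_of_connected {V : Type*} {K : SimpleGraph V} (hK : K.Connected) {S : Set V}
    {u v : V} (hu : u ∈ S) (hv : v ∉ S) : ∃ a ∈ S, ∃ b ∉ S, K.Adj a b := by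
  obtain ⟨p⟩ := hK.preconnected u v
  obtain ⟨d, -, h1, h2⟩ := p.exists_boundary_dart S hu hv
  exact ⟨_, h1, _, h2, d.adj⟩

theorem nonempty_iso_of_copy {V W : Type*} {F : SimpleGraph W} {K : SimpleGraph V}
    (f : Copy F K) (hf : Function.Surjective f)
    (h : ∀ a b, a ≠ b → ¬ F.Adj a b → ¬ K.Adj (f a) (f b)) : Nonempty (F ≃g K) := by
  refine ⟨⟨Equiv.ofBijective f ⟨f.injective, hf⟩, fun {a b} => ⟨fun hab => ?_, fun hab => ?_⟩⟩⟩
  · by_contra hn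
    by_cases he : a = b
    · subst he
      exact K.loopless.irrefl _ hab
    · exact h a b he hn hab
  · exact f.toHom.map_adj hab

/-- A connected graph containing a graph `F` either contains `F` with a further pendant edge, or
`F` with a further edge, or is isomorphic to `F`. -/
theorem pendant_or_edge_or_iso {V : Type*} {K : SimpleGraph V} (hK : K.Connected) {n : ℕ}
    {l : List (ℕ × ℕ)} (hn : 0 < n) (hl : ∀ p ∈ l, p.1 < n ∧ p.2 < n) (h : ofEdges n l ⊑ K) :
    (∃ a : Fin n, ofEdges (n + 1) ((a.1, n) :: l) ⊑ K) ∨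
    (∃ a b : Fin n, a ≠ b ∧ ¬ (ofEdges n l).Adj a b ∧ ofEdges n ((a.1, b.1) :: l) ⊑ K) ∨
    Nonempty (ofEdges n l ≃g K) := by
  obtain ⟨f⟩ := h
  by_cases hf : Function.Surjective f
  · by_cases hab : ∃ a b, a ≠ b ∧ ¬ (ofEdges n l).Adj a b ∧ K.Adj (f a) (f b)
    · obtain ⟨a, b, h1, h2, h3⟩ := hab
      exact Or.inr (Or.inl ⟨a, b, h1, h2, ofEdges_cons_isContained f h3⟩)
    · push Not at hab
      exact Or.inr (Or.inr (nonempty_iso_of_copy f hf hab))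
  · simp only [Function.Surjective, not_forall] at hf
    obtain ⟨v, hv⟩ := hf
    obtain ⟨_, ⟨a, rfl⟩, w, hw, haw⟩ := exists_adj_of_connected hK
      (S := Set.range f) (Set.mem_range_self ⟨0, hn⟩) hv
    exact Or.inl ⟨a, ofEdges_pendant_isContained hl f hw haw⟩

theorem smallEdges_lt : ∀ s : Fin 7, 0 < smallOrder s ∧
    ∀ p ∈ smallEdges s, p.1 < smallOrder s ∧ p.2 < smallOrder s := by
  decide

theorem minimal_or_small_iso {V : Type*} {K : SimpleGraph V} (hK : K.Connected) (s : Fin 7)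
    (h : smallGraph s ⊑ K) :
    (∃ j, minimalGraph j ⊑ K) ∨ ∃ t, Nonempty (smallGraph t ≃g K) := by
  induction hm : 7 - s.1 using Nat.strong_induction_on generalizing s with
  | _ m ih =>
    subst hm
    rcases pendant_or_edge_or_iso hK (smallEdges_lt s).1 (smallEdges_lt s).2 h with
      ⟨a, ha⟩ | ⟨a, b, hab, hadj, h1⟩ | h1
    · rcases small_pendant_check s a with h1 | h1
      · obtain ⟨r, -, hr⟩ := List.any_eq_true.mp h1
        exact Or.inl ⟨r.1, (isContained_of_isCopy hr).trans ha⟩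
      · obtain ⟨r, -, hr⟩ := List.any_eq_true.mp h1
        rw [Bool.and_eq_true, decide_eq_true_eq] at hr
        have : s.1 < r.1.1 := hr.1
        exact ih _ (by omega) r.1 ((isContained_of_isCopy hr.2).trans ha) rfl
    · obtain ⟨r, -, hr⟩ := List.any_eq_true.mp (small_edge_check s a b hab hadj)
      exact Or.inl ⟨r.1, (isContained_of_isCopy hr).trans h1⟩
    · exact Or.inr ⟨s, h1⟩

theorem two_lt_index_minimalGraph (i : Fin 18) : 2 < index (minimalGraph i) := by
  refine lt_index_of_lt_quad (fun u => (((minimalTest i).getD u.1 0 : ℕ) : ℝ)) ?_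
  have := minimalTest_check i
  unfold quad
  have h2 : ((2 * ∑ u : Fin (minimalOrder i), (minimalTest i).getD u.1 0 ^ 2 : ℕ) : ℝ) <
      ((∑ u : Fin (minimalOrder i), ∑ w : Fin (minimalOrder i),
        if (minimalGraph i).Adj u w then
          (minimalTest i).getD u.1 0 * (minimalTest i).getD w.1 0 else 0 : ℕ) : ℝ) :=
    Nat.cast_lt.mpr this
  push_cast at h2
  convert h2 using 4

theorem index_smallGraph_le_two (s : Fin 7) : index (smallGraph s) ≤ 2 := by
  refine index_le_two_of_superharmonic (fun u => (((smallHarmonic s).getD u.1 0 : ℕ) : ℝ))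
    (fun v => Nat.cast_pos.mpr (smallHarmonic_check s v).1) fun v => ?_
  have := (Nat.cast_le (α := ℝ)).mpr (smallHarmonic_check s v).2
  push_cast at this
  refine le_trans (le_of_eq (Finset.sum_congr rfl fun w _ => ?_)) this
  congr 1

/-- Every graph contains one of the minimal graphs of index greater than `2`, or one of the seven
small trees, or all its branch vertices have degree `3` and at least two neighbours of degree
`1`. -/
theorem minimal_or_small_or_forks {V : Type*} [Fintype V] [DecidableEq V] (K : SimpleGraph V)
    [DecidableRel K.Adj] :
    (∃ j, minimalGraph j ⊑ K) ∨ (∃ s, smallGraph s ⊑ K) ∨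
      ∀ v, 2 < K.degree v → K.degree v = 3 ∧
        2 ≤ ((K.neighborFinset v).filter fun w => K.degree w = 1).card := by
  by_contra hcon
  rw [not_or, not_or, not_exists, not_exists] at hcon
  obtain ⟨hF, hS, hcon⟩ := hcon
  push Not at hcon
  obtain ⟨v, hv, hforks⟩ := hcon
  have htri : ∀ a b c : V, K.Adj v a → K.Adj v b → K.Adj a b → K.Adj v c → c ≠ a → c ≠ b →
      False := by
    intro a b c ha hb hab hc hca hcb
    refine hF 3 (isContained_of_list [v, a, b, c] v rfl ?_ ?_)
    · simp [ha.ne, hb.ne, hc.ne, hab.ne, hca.symm, hcb.symm]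
    · simp [minimalEdges, ha, hab, hb.symm, hc]
  by_cases h3 : K.degree v = 3
  · have hcard : 2 ≤ ((K.neighborFinset v).filter fun w => K.degree w ≠ 1).card := by
      have := Finset.card_filter_add_card_filter_not (s := K.neighborFinset v)
        (fun w => K.degree w = 1)
      rw [card_neighborFinset_eq_degree] at this
      have := hforks h3
      simp only [ne_eq]
      omega
    obtain ⟨q, hq, s, hs, hqs⟩ := Finset.one_lt_card.mp hcard
    simp only [Finset.mem_filter, mem_neighborFinset] at hq hs
    obtain ⟨p, hp, hpq, hps⟩ : ∃ p, K.Adj v p ∧ p ≠ q ∧ p ≠ s := by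
      by_contra! hno
      have hsub : K.neighborFinset v ⊆ {q, s} := fun p hp => by
        rw [mem_neighborFinset] at hp
        by_cases h : p = q
        · simp [h]
        · simp [hno p hp h]
      have := Finset.card_le_card hsub
      rw [card_neighborFinset_eq_degree, h3] at this
      have := this.trans Finset.card_le_two
      omega
    have hnext : ∀ q, K.Adj v q → K.degree q ≠ 1 → ∃ r, K.Adj q r ∧ r ≠ v := by
      intro q hq h1
      by_contra! hno
      refine h1 ?_
      rw [← card_neighborFinset_eq_degree, Finset.card_eq_one]
      refine ⟨v, Finset.ext fun r => ?_⟩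
      rw [mem_neighborFinset, Finset.mem_singleton]
      exact ⟨hno r, fun h => h ▸ hq.symm⟩
    obtain ⟨q', hq', hq'v⟩ := hnext q hq.1 hq.2
    obtain ⟨s', hs', hs'v⟩ := hnext s hs.1 hs.2
    have hqv : ¬ K.Adj v q' := fun h => by
      by_cases h1 : q' = s
      · subst h1
        exact htri q q' p hq.1 h hq' hp hpq hps
      · exact htri q q' s hq.1 h hq' hs.1 hqs.symm (Ne.symm h1)
    have hsv : ¬ K.Adj v s' := fun h => by
      by_cases h1 : s' = q
      · subst h1
        exact htri s s' p hs.1 h hs' hp hps hpq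
      · exact htri s s' q hs.1 h hs' hq.1 hqs (Ne.symm h1)
    have n1 : ∀ {a}, K.Adj v a → a ≠ q' := fun h e => hqv (e ▸ h)
    have n2 : ∀ {a}, K.Adj v a → a ≠ s' := fun h e => hsv (e ▸ h)
    by_cases he : q' = s'
    · subst he
      refine hF 4 (isContained_of_list [v, q, q', s, p] v rfl ?_ ?_)
      · simp [hq.1.ne, hs.1.ne, hp.ne, hq'v.symm, hqs, hpq.symm, hps.symm, n1 hq.1,
          (n1 hs.1).symm, (n1 hp).symm]
      · simp [minimalEdges, hq.1, hs.1.symm, hp, hq', hs'.symm]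
    · refine hS 1 (isContained_of_list [v, p, q, q', s, s'] v rfl ?_ ?_)
      · simp [hq.1.ne, hs.1.ne, hp.ne, hq'v.symm, hs'v.symm, hqs, hpq, hps, n1 hq.1, n1 hp,
          (n1 hs.1).symm, n2 hq.1, n2 hs.1, n2 hp, he]
      · simp [smallEdges, hq.1, hs.1, hp, hq', hs']
  · have h4 : 4 ≤ (K.neighborFinset v).card := by
      rw [card_neighborFinset_eq_degree]; omega
    obtain ⟨t, ht, hc⟩ := Finset.exists_subset_card_eq h4
    have hadj : ∀ a ∈ t, K.Adj v a := fun a ha => by simpa using ht ha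
    refine hS 0 (isContained_of_list (v :: t.toList) v (by simp [hc]; rfl) ?_ ?_)
    · rw [List.nodup_cons]
      exact ⟨fun h => (hadj v (by simpa using h)).ne rfl, t.nodup_toList⟩
    · have hlen : t.toList.length = 4 := by simp [hc]
      have hk : ∀ k, k < 4 → K.Adj v ((v :: t.toList).getD (k + 1) v) := fun k hk => by
        rw [List.getD_cons_succ, List.getD_eq_getElem _ _ (by omega)]
        exact hadj _ (Finset.mem_toList.mp (List.getElem_mem _))
      intro p hp
      simp only [smallEdges, Matrix.cons_val_zero, List.mem_cons, List.not_mem_nil,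
        or_false] at hp
      rcases hp with rfl | rfl | rfl | rfl
      · exact hk 0 (by norm_num)
      · exact hk 1 (by norm_num)
      · exact hk 2 (by norm_num)
      · exact hk 3 (by norm_num)

theorem index_le_two_of_forks {V : Type*} [Fintype V] (K : SimpleGraph V)
    [DecidableRel K.Adj] (h : ∀ v, 2 < K.degree v → K.degree v = 3 ∧
        2 ≤ ((K.neighborFinset v).filter fun w => K.degree w = 1).card) : index K ≤ 2 := by
  classical
  refine index_le_two_of_superharmonic (fun v => if K.degree v = 1 then 1 else 2)
    (fun v => by split_ifs <;> norm_num) fun v => ?_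
  have hsum : ∑ w, (if K.Adj v w then (if K.degree w = 1 then (1 : ℝ) else 2) else 0) =
      2 * K.degree v - ((K.neighborFinset v).filter fun w => K.degree w = 1).card := by
    rw [← Finset.sum_filter]
    have : (Finset.univ.filter fun w => K.Adj v w) = K.neighborFinset v := by
      ext w; simp
    rw [this]
    have h2 : ∀ w, (if K.degree w = 1 then (1 : ℝ) else 2) =
        2 - if K.degree w = 1 then 1 else 0 := fun w => by split_ifs <;> norm_num
    simp only [h2, Finset.sum_sub_distrib, Finset.sum_boole, Finset.sum_const,
      card_neighborFinset_eq_degree, nsmul_eq_mul]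
    ring
  have h0 : (0 : ℝ) ≤ ((K.neighborFinset v).filter fun w => K.degree w = 1).card :=
    Nat.cast_nonneg _
  refine le_trans (le_of_eq ?_) (hsum.le.trans ?_)
  · refine Finset.sum_congr rfl fun w _ => ?_
    congr 1
  by_cases hv : 2 < K.degree v
  · obtain ⟨h3, h4⟩ := h v hv
    have : (2 : ℝ) ≤ ((K.neighborFinset v).filter fun w => K.degree w = 1).card := by
      exact_mod_cast h4
    rw [h3]
    norm_num
    linarith
  · split_ifs with h1
    · rw [h1]; norm_num
    · have : (K.degree v : ℝ) ≤ 2 := by exact_mod_cast not_lt.mp hv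
      linarith

theorem exists_minimalGraph_isContained {V : Type*} [Fintype V] {K : SimpleGraph V}
    (hK : K.Connected) (h : 2 < index K) : ∃ j, minimalGraph j ⊑ K := by
  classical
  rcases minimal_or_small_or_forks K with h1 | ⟨s, hs⟩ | h1
  · exact h1
  · rcases minimal_or_small_iso hK s hs with h2 | ⟨t, ⟨e⟩⟩
    · exact h2
    · exact absurd h (not_lt.mpr (index_congr e ▸ index_smallGraph_le_two t))
  · exact absurd h (not_lt.mpr (index_le_two_of_forks K h1))

theorem quad_le_of_support {V : Type*} [Fintype V] {G : SimpleGraph V} {c : ℝ} {s : Set V}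
    [Fintype s] (h : index (G.induce s) ≤ c) (z : V → ℝ) (hz : ∀ v ∉ s, z v = 0) :
    quad G z ≤ c * ∑ v, z v ^ 2 := by
  classical
  have he : z = Function.extend ((↑) : s → V) (fun v => z v) 0 := by
    funext v
    by_cases hv : v ∈ s
    · exact (Subtype.val_injective.extend_apply (fun v : s => z v) 0 ⟨v, hv⟩).symm
    · rw [Function.extend_apply' _ _ _ (by simpa using hv), hz v hv]
      rfl
  rw [he, quad_extend Subtype.val_injective, sum_sq_extend Subtype.val_injective]
  refine le_trans (le_of_eq ?_) ((quad_le_index (G := G.induce s) (fun v => z v)).trans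
    (mul_le_mul_of_nonneg_right h (by positivity)))
  unfold quad
  refine Finset.sum_congr rfl fun u _ => Finset.sum_congr rfl fun w _ => ?_
  congr 1

theorem IsMinimalIndexGtTwo.connected {V : Type*} [Fintype V] {K : SimpleGraph V}
    (hK : IsMinimalIndexGtTwo K) : K.Connected := by
  classical
  by_contra hcon
  have hne : Nonempty V := by
    by_contra hV
    have : Fintype.card V = 0 := Fintype.card_eq_zero_iff.mpr (not_nonempty_iff.mp hV)
    have h2 := hK.1
    simp [index, this] at h2
    linarith
  have hpre : ¬ K.Preconnected := fun h => hcon ⟨h⟩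
  simp only [Preconnected, not_forall] at hpre
  obtain ⟨u, v, huv⟩ := hpre
  let s : Finset V := Finset.univ.filter fun w => K.Reachable u w
  have hs : s ≠ Finset.univ := fun h => huv (by
    have : v ∈ s := h ▸ Finset.mem_univ v
    simpa [s] using this)
  have hsc : sᶜ ≠ Finset.univ := fun h => by
    have : u ∈ sᶜ := h ▸ Finset.mem_univ u
    simp [s] at this
  obtain ⟨x, hx⟩ := exists_lt_quad_of_lt_index zero_le_two hK.1
  let x₁ : V → ℝ := fun w => if w ∈ s then x w else 0
  let x₂ : V → ℝ := fun w => if w ∈ s then 0 else x w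
  have h1 : quad K x₁ ≤ 2 * ∑ w, x₁ w ^ 2 :=
    quad_le_of_support (hK.2 s hs) x₁ fun w hw => if_neg (by simpa using hw)
  have h2 : quad K x₂ ≤ 2 * ∑ w, x₂ w ^ 2 :=
    quad_le_of_support (hK.2 sᶜ hsc) x₂ fun w hw => if_pos (by simpa using hw)
  have hq : quad K x = quad K x₁ + quad K x₂ := by
    unfold quad
    rw [← Finset.sum_add_distrib]
    refine Finset.sum_congr rfl fun a _ => ?_
    rw [← Finset.sum_add_distrib]
    refine Finset.sum_congr rfl fun b _ => ?_
    by_cases hab : K.Adj a b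
    · have : a ∈ s ↔ b ∈ s := by
        simp only [s, Finset.mem_filter, Finset.mem_univ, true_and]
        exact ⟨fun h => h.trans hab.reachable, fun h => h.trans hab.symm.reachable⟩
      by_cases ha : a ∈ s
      · simp [hab, x₁, x₂, ha, this.mp ha]
      · have hb : b ∉ s := fun h => ha (this.mpr h)
        simp [hab, x₁, x₂, ha, hb]
    · simp [hab]
  have hn : ∑ w, x w ^ 2 = ∑ w, x₁ w ^ 2 + ∑ w, x₂ w ^ 2 := by
    rw [← Finset.sum_add_distrib]
    refine Finset.sum_congr rfl fun w _ => ?_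
    by_cases hw : w ∈ s <;> simp [x₁, x₂, hw]
  rw [hq, hn] at hx
  linarith

theorem IsMinimalIndexGtTwo.surjective_of_copy {V W : Type*} [Fintype V] [Fintype W]
    {K : SimpleGraph V} {F : SimpleGraph W} (hK : IsMinimalIndexGtTwo K) (hF : 2 < index F)
    (f : Copy F K) : Function.Surjective f := by
  classical
  intro v
  by_contra hv
  let s : Finset V := Finset.univ.image f
  have hs : s ≠ Finset.univ := fun h => hv (by
    have : v ∈ s := h ▸ Finset.mem_univ v
    simpa [s] using this)
  have h1 : F ⊑ K.induce (s : Set V) :=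
    ⟨⟨⟨fun w => ⟨f w, by simp [s]⟩, fun {a b} hab => f.toHom.map_adj hab⟩,
      fun a b hab => f.injective (congrArg Subtype.val hab)⟩⟩
  exact absurd (hF.trans_le (index_mono h1)) (not_lt.mpr (hK.2 s hs))

/-- Every minimal graph of index greater than `2` is isomorphic to one of the 18 graphs. -/
theorem IsMinimalIndexGtTwo.exists_iso {V : Type*} [Fintype V] {K : SimpleGraph V}
    (hK : IsMinimalIndexGtTwo K) : ∃ i, Nonempty (K ≃g minimalGraph i) := by
  classical
  have hne : (Finset.univ.filter fun j => minimalGraph j ⊑ K).Nonempty := by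
    obtain ⟨j, hj⟩ := exists_minimalGraph_isContained hK.connected hK.1
    exact ⟨j, by simpa using hj⟩
  obtain ⟨i, hi, hmax⟩ := Finset.exists_max_image _ (fun j => (minimalEdges j).length) hne
  simp only [Finset.mem_filter, Finset.mem_univ, true_and] at hi hmax
  have hord : ∀ j, minimalGraph j ⊑ K → minimalOrder j = Fintype.card V := fun j ⟨f⟩ => by
    have := Fintype.card_of_bijective
      ⟨f.injective, hK.surjective_of_copy (two_lt_index_minimalGraph j) f⟩
    simpa using this
  obtain ⟨f⟩ := hi
  obtain ⟨e⟩ := nonempty_iso_of_copy f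
      (hK.surjective_of_copy (two_lt_index_minimalGraph i) f) fun a b hab hn hadj => by
    obtain ⟨r, -, hr⟩ := List.any_eq_true.mp (minimal_edge_check i a b hab hn)
    rw [Bool.and_eq_true, decide_eq_true_eq] at hr
    have hr2 : minimalGraph r.1 ⊑ K :=
      (isContained_of_isCopy hr.2).trans (ofEdges_cons_isContained f hadj)
    have h1 := hord i ⟨f⟩
    have h2 := hord r.1 hr2
    have h3 := hmax r.1 hr2
    omega
  exact ⟨i, ⟨e.symm⟩⟩

theorem isMinimalIndexGtTwo_minimalGraph (i : Fin 18) : IsMinimalIndexGtTwo (minimalGraph i) := by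
  classical
  refine ⟨two_lt_index_minimalGraph i, fun s hs => ?_⟩
  obtain ⟨v, hv⟩ : ∃ v, v ∉ s := by
    by_contra! h
    exact hs (Finset.eq_univ_iff_forall.mpr h)
  have hne : ∀ u : (s : Set (Fin (minimalOrder i))), (u : Fin (minimalOrder i)) ≠ v :=
    fun u h => hv (h ▸ u.2)
  let y : Fin (minimalOrder i) → ℝ := fun u =>
    ((((minimalHarmonic i).getD v.1 []).getD u.1 0 : ℕ) : ℝ)
  refine index_le_two_of_superharmonic (fun u => y u)
    (fun u => Nat.cast_pos.mpr (minimalHarmonic_check i v u (hne u)).1) fun u => ?_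
  have h1 := (Nat.cast_le (α := ℝ)).mpr (minimalHarmonic_check i v u (hne u)).2
  push_cast at h1
  refine le_trans ?_ h1
  have h3 : ∑ w : (s : Set (Fin (minimalOrder i))),
        (fun w => if (minimalGraph i).Adj u w ∧ w ≠ v then y w else 0) (w : Fin (minimalOrder i)) =
      ∑ w ∈ s, if (minimalGraph i).Adj u w ∧ w ≠ v then y w else 0 :=
    Finset.sum_coe_sort s (fun w => if (minimalGraph i).Adj u w ∧ w ≠ v then y w else 0)
  refine le_trans (le_of_eq (Finset.sum_congr rfl fun w _ => ?_))
    (h3.le.trans ((Finset.sum_le_sum_of_subset_of_nonneg (Finset.subset_univ s)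
      fun w _ _ => ?_).trans (le_of_eq ?_)))
  · simp [hne w]
  · split_ifs
    · exact Nat.cast_nonneg _
    · exact le_rfl
  · refine Finset.sum_congr rfl fun w _ => ?_
    congr 1

theorem isEmpty_minimalGraph_iso {i j : Fin 18} (hij : i ≠ j) :
    IsEmpty (minimalGraph i ≃g minimalGraph j) := by
  refine ⟨fun e => ?_⟩
  have hc : minimalOrder i = minimalOrder j := by
    simpa using Fintype.card_congr e.toEquiv
  refine minimal_invariant_check i j hij hc ?_
  rw [← e.toEquiv.sum_comp]
  refine Finset.sum_congr rfl fun u _ => ?_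
  rw [← e.toEquiv.sum_comp]
  congr 1
  refine Finset.sum_congr rfl fun w _ => ?_
  have : (minimalGraph j).Adj (e.toEquiv u) (e.toEquiv w) ↔ (minimalGraph i).Adj u w :=
    e.map_adj_iff
  simp only [this]

end Classification

section Decomposition

theorem IsMinimalIndexGtTwo.existsUnique_eigenvalue {V : Type*} [Fintype V] {K : SimpleGraph V}
    (hK : IsMinimalIndexGtTwo K) : ∃! i, 2 < eigenvalue K i := by
  classical
  have hpos : 0 < Fintype.card V := by
    by_contra h
    have h2 := hK.1
    rw [index, dif_neg h] at h2
    linarith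
  have h0 : 2 < eigenvalue K ⟨0, hpos⟩ := by
    have h2 := hK.1
    rwa [index, dif_pos hpos] at h2
  refine ⟨⟨0, hpos⟩, h0, fun i hi => ?_⟩
  by_contra hne
  obtain ⟨v⟩ := Fintype.card_pos_iff.mp hpos
  obtain ⟨x, hx, hq⟩ := exists_lt_quad_of_two_eigenvalues hne hi h0 v
  refine absurd hq (not_lt.mpr (quad_le_of_support
    (hK.2 (Finset.univ.erase v) (Finset.erase_ssubset (Finset.mem_univ v)).ne) x fun w hw => ?_))
  have : w = v := by simpa using hw
  rw [this, hx]

theorem exists_support_of_lt_index {V : Type*} [Fintype V] {G : SimpleGraph V} {c : ℝ}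
    (hc : 0 ≤ c) {s : Set V} [Fintype s] (h : c < index (G.induce s)) :
    ∃ z : V → ℝ, (∀ v ∉ s, z v = 0) ∧ c * ∑ v, z v ^ 2 < quad G z := by
  classical
  obtain ⟨x, hx⟩ := exists_lt_quad_of_lt_index hc h
  refine ⟨Function.extend ((↑) : s → V) x 0, fun v hv => ?_, ?_⟩
  · rw [Function.extend_apply' _ _ _ (by simpa using hv)]
    rfl
  · rw [quad_extend Subtype.val_injective, sum_sq_extend Subtype.val_injective]
    refine hx.trans_eq ?_
    unfold quad
    refine Finset.sum_congr rfl fun u _ => Finset.sum_congr rfl fun w _ => ?_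
    congr 1

/-- Two non-adjacent disjoint sets of vertices inducing subgraphs of index greater than `2` force
the second largest eigenvalue to be greater than `2`. -/
theorem two_lt_secondEigenvalue {V : Type*} [Fintype V] {G : SimpleGraph V} {s t : Set V}
    [Fintype s] [Fintype t] (hst : Disjoint s t) (hadj : ∀ u ∈ s, ∀ w ∈ t, ¬ G.Adj u w)
    (hs : 2 < index (G.induce s)) (ht : 2 < index (G.induce t)) : 2 < secondEigenvalue G := by
  classical
  obtain ⟨x, hx0, hx⟩ := exists_support_of_lt_index zero_le_two hs
  obtain ⟨y, hy0, hy⟩ := exists_support_of_lt_index zero_le_two ht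
  have hcard : 1 < Fintype.card V := by
    by_contra h
    have : Subsingleton V := Fintype.card_le_one_iff_subsingleton.mp (not_lt.mp h)
    have h0 : quad G x = 0 := by
      unfold quad
      refine Finset.sum_eq_zero fun u _ => Finset.sum_eq_zero fun w _ => if_neg fun huw => ?_
      exact huw.ne (Subsingleton.elim _ _)
    rw [h0] at hx
    have : 0 ≤ 2 * ∑ v, x v ^ 2 := by positivity
    linarith
  refine lt_secondEigenvalue x y (fun a b hab => ?_) hcard
  have hxy : ∀ v, x v * y v = 0 := fun v => by
    by_cases hv : v ∈ s
    · rw [hy0 v (Set.disjoint_left.mp hst hv), mul_zero]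
    · rw [hx0 v hv, zero_mul]
  have hcross : ∀ u w, G.Adj u w → x u * y w = 0 := fun u w huw => by
    by_cases hu : u ∈ s
    · by_cases hw : w ∈ t
      · exact absurd huw (hadj u hu w hw)
      · rw [hy0 w hw, mul_zero]
    · rw [hx0 u hu, zero_mul]
  have hq : quad G (fun v => a * x v + b * y v) = a ^ 2 * quad G x + b ^ 2 * quad G y := by
    unfold quad
    simp only [Finset.mul_sum, ← Finset.sum_add_distrib]
    refine Finset.sum_congr rfl fun u _ => Finset.sum_congr rfl fun w _ => ?_
    split_ifs with huw
    · have h1 := hcross u w huw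
      have h2 := hcross w u huw.symm
      linear_combination a * b * h1 + a * b * h2
    · ring
  have hn : ∑ v, (a * x v + b * y v) ^ 2 = a ^ 2 * ∑ v, x v ^ 2 + b ^ 2 * ∑ v, y v ^ 2 := by
    simp only [Finset.mul_sum, ← Finset.sum_add_distrib]
    refine Finset.sum_congr rfl fun v _ => ?_
    linear_combination 2 * a * b * hxy v
  rw [hq, hn]
  rcases hab with h | h
  · have := sq_pos_of_ne_zero h
    nlinarith [sq_nonneg b]
  · have := sq_pos_of_ne_zero h
    nlinarith [sq_nonneg a]

theorem exists_isMinimalIndexGtTwo {V : Type*} [Fintype V] {G : SimpleGraph V}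
    (h : 2 < index G) : ∃ M : Finset V, IsMinimalIndexGtTwo (G.induce (M : Set V)) := by
  classical
  have hne : (Finset.univ.filter fun M : Finset V => 2 < index (G.induce (M : Set V))).Nonempty := by
    refine ⟨Finset.univ, ?_⟩
    simp only [Finset.mem_filter, Finset.mem_univ, true_and]
    refine h.trans_le (index_mono ⟨⟨⟨fun v => ⟨v, by simp⟩, fun {a b} hab => hab⟩, ?_⟩⟩)
    exact fun a b hab => congrArg Subtype.val hab
  obtain ⟨M, hM, hmin⟩ := Finset.exists_min_image _ Finset.card hne
  simp only [Finset.mem_filter, Finset.mem_univ, true_and] at hM hmin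
  refine ⟨M, hM, fun s hs => ?_⟩
  by_contra! hlt
  let t : Finset V := s.map (Function.Embedding.subtype _)
  have h1 : (G.induce (M : Set V)).induce (s : Set (M : Set V)) ⊑ G.induce (t : Set V) := by
    refine ⟨⟨⟨fun v => ⟨v.1.1, ?_⟩, fun {a b} hab => hab⟩, ?_⟩⟩
    · exact Finset.mem_coe.mpr (Finset.mem_map.mpr ⟨v.1, v.2, rfl⟩)
    · exact fun a b hab => Subtype.ext (Subtype.ext (Subtype.mk.inj hab))
  have h2 := hmin t (hlt.trans_le (index_mono h1))
  have h3 : t.card < M.card := by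
    rw [Finset.card_map]
    have h4 : s.card < Fintype.card (M : Set V) := by
      obtain ⟨v, hv⟩ : ∃ v, v ∉ s := by
        by_contra! h
        exact hs (Finset.eq_univ_iff_forall.mpr h)
      exact Finset.card_lt_univ_of_notMem hv
    simpa using h4
  omega

theorem exists_decomposition {V : Type*} [Fintype V] [DecidableEq V] {G : SimpleGraph V}
    (h : 2 < index G) (h2 : secondEigenvalue G ≤ 2) :
    ∃ M A H : Finset V,
      (M ∪ A ∪ H = Finset.univ ∧ Disjoint M A ∧ Disjoint M H ∧ Disjoint A H) ∧
      IsMinimalIndexGtTwo (G.induce (M : Set V)) ∧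
      (∀ v : V, v ∈ A ↔ v ∉ M ∧ ∃ m ∈ M, G.Adj v m) ∧
      index (G.induce (H : Set V)) ≤ 2 := by
  classical
  obtain ⟨M, hM⟩ := exists_isMinimalIndexGtTwo h
  let A : Finset V := Finset.univ.filter fun v => v ∉ M ∧ ∃ m ∈ M, G.Adj v m
  have hA : ∀ v, v ∈ A ↔ v ∉ M ∧ ∃ m ∈ M, G.Adj v m := fun v => by simp [A]
  have hMH : Disjoint M (Finset.univ \ (M ∪ A)) :=
    Finset.disjoint_sdiff.mono_left Finset.subset_union_left
  refine ⟨M, A, Finset.univ \ (M ∪ A), ⟨Finset.union_sdiff_of_subset (Finset.subset_univ _), ?_, hMH, ?_⟩, hM, hA, ?_⟩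
  · exact Finset.disjoint_left.mpr fun v hv hvA => ((hA v).mp hvA).1 hv
  · exact Finset.disjoint_sdiff.mono_left Finset.subset_union_right
  · by_contra! hlt
    refine absurd (two_lt_secondEigenvalue (Finset.disjoint_coe.mpr hMH) ?_ hM.1 hlt)
      (not_lt.mpr h2)
    intro u hu w hw huw
    simp only [Finset.coe_sdiff, Set.mem_sdiff, Finset.mem_coe, Finset.mem_union, not_or] at hw
    exact hw.2.2 ((hA w).mpr ⟨hw.2.1, u, hu, huw.symm⟩)

end Decomposition

section Degrees

variable {V : Type*} [Fintype V] {K : SimpleGraph V} [DecidableRel K.Adj]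

theorem sum_two_sub_degree_le (hK : K.Connected) : ∑ v, (2 - (K.degree v : ℤ)) ≤ 2 := by
  classical
  have h1 := hK.card_vert_le_card_edgeSet_add_one
  have h2 := K.sum_degrees_eq_twice_card_edges
  rw [Nat.card_eq_fintype_card, Nat.card_eq_fintype_card, ← edgeFinset_card] at h1
  have h3 : ((∑ v, K.degree v : ℕ) : ℤ) = 2 * (K.edgeFinset.card : ℤ) := by
    rw [h2]; push_cast; ring
  push_cast at h3
  rw [Finset.sum_sub_distrib, h3]
  simp only [Finset.sum_const, Finset.card_univ, nsmul_eq_mul]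
  have h4 : (Fintype.card V : ℤ) ≤ K.edgeFinset.card + 1 := by exact_mod_cast h1
  linarith

/-- A connected graph of index at most `2` has at most two vertices of degree greater than `2`. -/
theorem card_branch_le_two (hK : K.Connected) (h : index K ≤ 2) :
    (Finset.univ.filter fun v => 2 < K.degree v).card ≤ 2 := by
  classical
  have hfree : ¬ ∃ j, minimalGraph j ⊑ K := fun ⟨j, hj⟩ =>
    absurd ((two_lt_index_minimalGraph j).trans_le (index_mono hj)) (not_lt.mpr h)
  rcases minimal_or_small_or_forks K with h1 | ⟨s, hs⟩ | hforks
  · exact absurd h1 hfree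
  · rcases minimal_or_small_iso hK s hs with h2 | ⟨t, ⟨e⟩⟩
    · exact absurd h2 hfree
    · refine le_trans (Finset.card_le_one.mpr fun a ha b hb => ?_) one_le_two
      have key : ∀ a, 2 < K.degree a → (e.symm a).1 = 0 := fun a ha => by
        by_contra h0
        have h3 := small_degree_check t (e.symm a) h0
        rw [← Finset.card_filter] at h3
        have h4 : (smallGraph t).degree (e.symm a) = K.degree a := e.symm.degree_eq a
        rw [← card_neighborFinset_eq_degree, neighborFinset_eq_filter] at h4
        omega
      simp only [Finset.mem_filter, Finset.mem_univ, true_and] at ha hb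
      exact e.symm.injective (Fin.ext ((key a ha).trans (key b hb).symm))
  · set T := Finset.univ.filter fun v => 2 < K.degree v with hT
    set L := Finset.univ.filter fun v => K.degree v = 1 with hL
    have h1 : (L.card : ℤ) - T.card ≤ ∑ v, (2 - (K.degree v : ℤ)) := by
      rw [hL, hT, Finset.card_filter, Finset.card_filter]
      push_cast
      rw [← Finset.sum_sub_distrib]
      refine Finset.sum_le_sum fun v _ => ?_
      by_cases h3 : 2 < K.degree v
      · have := (hforks v h3).1
        simp [this]
      · by_cases h4 : K.degree v = 1
        · simp [h4]
        · simp only [h3, h4, if_false]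
          omega
    have h2 : 2 * T.card ≤ L.card := by
      have hdisj : (T : Set V).PairwiseDisjoint
          fun v => (K.neighborFinset v).filter fun w => K.degree w = 1 := by
        intro u _ v _ huv
        refine Finset.disjoint_left.mpr fun w hu hv => huv ?_
        simp only [Finset.mem_filter, mem_neighborFinset] at hu hv
        have := hu.2
        rw [← card_neighborFinset_eq_degree] at this
        exact Finset.card_le_one.mp this.le u (by simpa using hu.1.symm) v
          (by simpa using hv.1.symm)
      calc 2 * T.card = ∑ v ∈ T, 2 := by simp [mul_comm]
        _ ≤ ∑ v ∈ T, ((K.neighborFinset v).filter fun w => K.degree w = 1).card :=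
          Finset.sum_le_sum fun v hv => (hforks v (by simpa [hT] using hv)).2
        _ = (T.biUnion fun v => (K.neighborFinset v).filter fun w => K.degree w = 1).card :=
          (Finset.card_biUnion hdisj).symm
        _ ≤ L.card := Finset.card_le_card fun w hw => by
          simp only [Finset.mem_biUnion, Finset.mem_filter] at hw
          obtain ⟨v, -, -, hw⟩ := hw
          simp [hL, hw]
    have h3 := h1.trans (sum_two_sub_degree_le hK)
    omega

theorem card_branch_le_two_mul_card_components (h : index K ≤ 2) :
    (Finset.univ.filter fun v => 2 < K.degree v).card ≤
      2 * Nat.card K.ConnectedComponent := by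
  classical
  have := Fintype.ofFinite K.ConnectedComponent
  rw [Nat.card_eq_fintype_card]
  rw [Finset.card_eq_sum_card_fiberwise (f := K.connectedComponentMk) (t := Finset.univ)
    (fun _ _ => Finset.mem_coe.mpr (Finset.mem_univ _))]
  refine (Finset.sum_le_card_nsmul _ _ 2 fun c _ => ?_).trans (by simp [mul_comm])
  have hc : index c.toSimpleGraph ≤ 2 :=
    (index_mono (F := c.toSimpleGraph) ⟨Copy.induce K c.supp⟩).trans h
  refine le_trans ?_ (card_branch_le_two c.connected_toSimpleGraph hc)
  refine Finset.card_le_card_of_surjOn (fun v => v.1) fun v hv => ?_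
  simp only [Finset.coe_filter, Finset.mem_filter, Finset.mem_univ, true_and,
    Set.mem_ofPred_eq] at hv
  have hmem : v ∈ c.supp := hv.2
  refine ⟨⟨v, hmem⟩, ?_, rfl⟩
  simp only [Finset.coe_filter, Finset.mem_univ, true_and, Set.mem_ofPred_eq]
  refine hv.1.trans_le ?_
  rw [← card_neighborFinset_eq_degree, ← card_neighborFinset_eq_degree]
  refine Finset.card_le_card_of_surjOn (fun w => w.1) fun w hw => ?_
  have hw : K.Adj v w := by simpa using hw
  refine ⟨⟨w, c.mem_supp_of_adj_mem_supp hmem hw⟩, ?_, rfl⟩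
  rw [Finset.mem_coe, mem_neighborFinset]
  exact hw

/-- If each edge leaving `H` ends in `A`, then each component of the subgraph induced on `H`
contains a neighbour of `A`. -/
theorem card_components_le [DecidableEq V] (hK : K.Connected) {A H : Finset V} {m : V} (hm : m ∉ H)
    (hAH : ∀ a ∈ H, ∀ b ∉ H, K.Adj a b → b ∈ A) :
    Nat.card (K.induce (H : Set V)).ConnectedComponent ≤
      (A.biUnion fun v => K.neighborFinset v).card := by
  have key : ∀ c : (K.induce (H : Set V)).ConnectedComponent,
      ∃ v : (H : Set V), v.1 ∈ A.biUnion (fun v => K.neighborFinset v) ∧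
        (K.induce (H : Set V)).connectedComponentMk v = c := by
    intro c
    obtain ⟨u, rfl⟩ := c.exists_rep
    let S : Set V := {v | ∃ h : v ∈ (H : Set V),
      (K.induce (H : Set V)).connectedComponentMk ⟨v, h⟩ =
        (K.induce (H : Set V)).connectedComponentMk u}
    have hu : u.1 ∈ S := ⟨u.2, rfl⟩
    have hmS : m ∉ S := fun ⟨h, _⟩ => hm h
    obtain ⟨a, ⟨haH, hac⟩, b, hb, hab⟩ := exists_adj_of_connected hK hu hmS
    refine ⟨⟨a, haH⟩, Finset.mem_biUnion.mpr ⟨b, hAH a haH b (fun hbH => ?_) hab,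
      by simpa using hab.symm⟩, hac⟩
    refine hb ⟨hbH, (ConnectedComponent.connectedComponentMk_eq_of_adj ?_).trans hac⟩
    exact hab.symm
  choose g hg1 hg2 using key
  have := Fintype.ofFinite (K.induce (H : Set V)).ConnectedComponent
  rw [Nat.card_eq_fintype_card, ← Finset.card_univ]
  refine Finset.card_le_card_of_injOn (fun c => (g c).1) (fun c _ => Finset.mem_coe.mpr (hg1 c))
    fun c _ d _ hcd => ?_
  rw [← hg2 c, ← hg2 d, Subtype.ext hcd]

theorem card_branch_le [DecidableEq V] {D : ℕ} (hK : K.Connected) (hD : ∀ v, K.degree v ≤ D)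
    {M A H : Finset V} (hcover : M ∪ A ∪ H = Finset.univ) (hMH : Disjoint M H)
    (hAH : Disjoint A H) (hM : M.Nonempty) (hA : ∀ v, v ∈ A ↔ v ∉ M ∧ ∃ m ∈ M, K.Adj v m)
    (hH : index (K.induce (H : Set V)) ≤ 2) :
    (Finset.univ.filter fun v => 2 < K.degree v).card ≤ M.card * (3 * D ^ 2 + D + 1) := by
  have hnbr : ∀ S : Finset V, (S.biUnion fun v => K.neighborFinset v).card ≤ S.card * D :=
    fun S => Finset.card_biUnion_le_card_mul _ _ _ fun v _ => by
      rw [card_neighborFinset_eq_degree]; exact hD v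
  have hAc : A.card ≤ M.card * D := by
    refine (Finset.card_le_card fun v hv => ?_).trans (hnbr M)
    obtain ⟨-, m, hm, hvm⟩ := (hA v).mp hv
    exact Finset.mem_biUnion.mpr ⟨m, hm, by simpa using hvm.symm⟩
  have hNc := (hnbr A).trans (Nat.mul_le_mul_right D hAc)
  have hexit : ∀ a ∈ H, ∀ b ∉ H, K.Adj a b → b ∈ A := fun a ha b hb hab => by
    have hbM : b ∉ M := fun h => Finset.disjoint_left.mp hAH ((hA a).mpr
      ⟨fun h => Finset.disjoint_left.mp hMH h ha, b, h, hab⟩) ha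
    have : b ∈ M ∪ A ∪ H := hcover ▸ Finset.mem_univ b
    simpa [hbM, hb] using this
  obtain ⟨m, hm⟩ := hM
  have hcomp := card_components_le hK (Finset.disjoint_left.mp hMH hm) hexit
  have hbr := (card_branch_le_two_mul_card_components hH).trans (Nat.mul_le_mul_left 2 hcomp)
  generalize hN : (A.biUnion fun v => K.neighborFinset v) = N at hNc hbr
  have hsub : (Finset.univ.filter fun v => 2 < K.degree v) ⊆ M ∪ A ∪ N ∪
      (Finset.univ.filter fun v => 2 < (K.induce (H : Set V)).degree v).map
        (Function.Embedding.subtype _) := by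
    intro v hv
    simp only [Finset.mem_filter, Finset.mem_univ, true_and] at hv
    by_cases h1 : v ∈ M ∪ A ∪ N
    · exact Finset.mem_union_left _ h1
    · have hvH : v ∈ H := by
        have h2 : v ∈ M ∪ A ∪ H := hcover ▸ Finset.mem_univ v
        rcases Finset.mem_union.mp h2 with h2 | h2
        · exact absurd (Finset.mem_union_left _ h2) h1
        · exact h2
      have h3 : v ∉ N := fun h => h1 (Finset.mem_union_right _ h)
      refine Finset.mem_union_right _ (Finset.mem_map.mpr ⟨⟨v, hvH⟩, ?_, rfl⟩)
      simp only [Finset.mem_filter, Finset.mem_univ, true_and]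
      refine hv.trans_le ?_
      rw [← card_neighborFinset_eq_degree, ← card_neighborFinset_eq_degree]
      refine Finset.card_le_card_of_surjOn (fun w => w.1) fun w hw => ?_
      have hw : K.Adj v w := by simpa using hw
      have hwH : w ∈ H := by
        by_contra h
        exact h3 (hN ▸ Finset.mem_biUnion.mpr ⟨w, hexit v hvH w h hw, by simpa using hw.symm⟩)
      refine ⟨⟨w, hwH⟩, ?_, rfl⟩
      rw [Finset.mem_coe, mem_neighborFinset]
      exact hw
  have h1 := (Finset.card_le_card hsub).trans (Finset.card_union_le _ _)
  rw [Finset.card_map] at h1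
  have h3 := Finset.card_union_le (M ∪ A) N
  have h4 := Finset.card_union_le M A
  have h5 : M.card * (3 * D ^ 2 + D + 1) =
      M.card + M.card * D + M.card * D * D + 2 * (M.card * D * D) := by ring
  linarith

theorem index_le_two_of_degree_le_two (h : ∀ v, K.degree v ≤ 2) : index K ≤ 2 :=
  index_le_two_of_forks K fun v hv => absurd hv (not_lt.mpr (h v))

/-- The number of leaves of a connected graph of index greater than `2`, in terms of its branch
vertices. -/
theorem card_leaves_le {D : ℕ} (hK : K.Connected) (h : 2 < index K) (hD : ∀ v, K.degree v ≤ D) :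
    (Finset.univ.filter fun v => K.degree v = 1).card ≤
      D * (Finset.univ.filter fun v => 2 < K.degree v).card := by
  classical
  set T := Finset.univ.filter fun v => 2 < K.degree v with hT
  set L := Finset.univ.filter fun v => K.degree v = 1 with hL
  have hpos : 1 ≤ T.card := by
    by_contra! h0
    have : T = ∅ := Finset.card_eq_zero.mp (by omega)
    refine absurd h (not_lt.mpr (index_le_two_of_degree_le_two fun v => ?_))
    by_contra! hv
    have hvT : v ∈ T := by simpa [hT] using hv
    rw [this] at hvT
    exact Finset.notMem_empty v hvT
  have h1 : (L.card : ℤ) - T.card * ((D : ℤ) - 2) ≤ ∑ v, (2 - (K.degree v : ℤ)) := by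
    rw [hL, hT, Finset.card_filter, Finset.card_filter]
    push_cast
    rw [Finset.sum_mul, ← Finset.sum_sub_distrib]
    refine Finset.sum_le_sum fun v _ => ?_
    have hv : (K.degree v : ℤ) ≤ D := by exact_mod_cast hD v
    by_cases h3 : 2 < K.degree v
    · have h4 : K.degree v ≠ 1 := by omega
      simp only [h3, h4, if_true, if_false]
      linarith
    · by_cases h4 : K.degree v = 1
      · simp [h4]
      · simp only [h3, h4, if_false]
        omega
  have h2 := h1.trans (sum_two_sub_degree_le hK)
  have h3 : (1 : ℤ) ≤ T.card := by exact_mod_cast hpos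
  have h4 : (L.card : ℤ) ≤ D * T.card := by linarith
  exact_mod_cast h4

end Degrees

end GraphIndex

theorem mainTheorem5 :
    -- the 18 listed graphs are, up to isomorphism, exactly the minimal graphs of index `> 2`
    ((∀ i : Fin 18, GraphIndex.IsMinimalIndexGtTwo (GraphIndex.minimalGraph i)) ∧
      (∀ i j : Fin 18, i ≠ j →
        IsEmpty (GraphIndex.minimalGraph i ≃g GraphIndex.minimalGraph j)) ∧
      (∀ (n : ℕ) (K : SimpleGraph (Fin n)), GraphIndex.IsMinimalIndexGtTwo K →
        ∃ i : Fin 18, Nonempty (K ≃g GraphIndex.minimalGraph i))) ∧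
    ∀ (V : Type*) [Fintype V] [DecidableEq V] (G : SimpleGraph V) [DecidableRel G.Adj],
      G.Connected → 2 < GraphIndex.index G → GraphIndex.secondEigenvalue G ≤ 2 →
      -- (a)
      (∃ M A H : Finset V,
        (M ∪ A ∪ H = Finset.univ ∧ Disjoint M A ∧ Disjoint M H ∧ Disjoint A H) ∧
        (∃ i : Fin 18, Nonempty (G.induce (M : Set V) ≃g GraphIndex.minimalGraph i)) ∧
        GraphIndex.IsMinimalIndexGtTwo (G.induce (M : Set V)) ∧
        (∃! i, 2 < GraphIndex.eigenvalue (G.induce (M : Set V)) i) ∧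
        (∀ v : V, v ∈ A ↔ v ∉ M ∧ ∃ m ∈ M, G.Adj v m) ∧
        GraphIndex.IsCyclotomic (G.induce (H : Set V))) ∧
      -- (b)
      (((Finset.univ.filter fun v : V => 2 < G.degree v).card : ℝ) ≤
          10 * (3 * GraphIndex.index G ^ 4 + GraphIndex.index G ^ 2 + 1) ∧
        ((Finset.univ.filter fun v : V => G.degree v = 1).card : ℝ) ≤
          GraphIndex.index G ^ 2 *
            (10 * (3 * GraphIndex.index G ^ 4 + GraphIndex.index G ^ 2 + 1))) := by
  refine ⟨⟨GraphIndex.isMinimalIndexGtTwo_minimalGraph,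
    fun i j hij => GraphIndex.isEmpty_minimalGraph_iso hij,
    fun n K hK => hK.exists_iso⟩, ?_⟩
  intro V _ _ G _ hG hindex hsecond
  obtain ⟨M, A, H, hpart, hM, hA, hH⟩ := GraphIndex.exists_decomposition hindex hsecond
  obtain ⟨i, ⟨e⟩⟩ := hM.exists_iso
  refine ⟨⟨M, A, H, hpart, ⟨i, ⟨e⟩⟩, hM, hM.existsUnique_eigenvalue, hA,
    GraphIndex.isCyclotomic_of_index_le_two hH⟩, ?_⟩
  have hMcard : M.card = GraphIndex.minimalOrder i := by
    simpa using Fintype.card_congr e.toEquiv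
  have horder : ∀ i, 0 < GraphIndex.minimalOrder i ∧ GraphIndex.minimalOrder i ≤ 10 := by decide
  have hMne : M.Nonempty := Finset.card_pos.mp (hMcard ▸ (horder i).1)
  obtain ⟨v₀, hv₀⟩ : ∃ v, G.maxDegree = G.degree v := by
    have := hG.nonempty
    exact G.exists_maximal_degree_vertex
  set lam := GraphIndex.index G
  have hD : (G.maxDegree : ℝ) ≤ lam ^ 2 := by
    rw [hv₀]
    exact GraphIndex.degree_le_index_sq v₀
  have hbranch := (GraphIndex.card_branch_le hG G.degree_le_maxDegree hpart.1 hpart.2.2.1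
    hpart.2.2.2 hMne hA hH).trans (Nat.mul_le_mul_right _ (hMcard ▸ (horder i).2))
  have hleaves := GraphIndex.card_leaves_le hG hindex G.degree_le_maxDegree
  have hbranch' : ((Finset.univ.filter fun v : V => 2 < G.degree v).card : ℝ) ≤
      10 * (3 * lam ^ 4 + lam ^ 2 + 1) := by
    have h1 : ((Finset.univ.filter fun v : V => 2 < G.degree v).card : ℝ) ≤
        10 * (3 * (G.maxDegree : ℝ) ^ 2 + G.maxDegree + 1) := by exact_mod_cast hbranch
    have h2 : (G.maxDegree : ℝ) ^ 2 ≤ lam ^ 4 := by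
      calc (G.maxDegree : ℝ) ^ 2 ≤ (lam ^ 2) ^ 2 :=
            pow_le_pow_left₀ (Nat.cast_nonneg _) hD 2
        _ = lam ^ 4 := by ring
    linarith
  refine ⟨hbranch', ?_⟩
  have h1 : ((Finset.univ.filter fun v : V => G.degree v = 1).card : ℝ) ≤
      G.maxDegree * (Finset.univ.filter fun v : V => 2 < G.degree v).card := by
    exact_mod_cast hleaves
  exact h1.trans (mul_le_mul hD hbranch' (Nat.cast_nonneg _) (sq_nonneg _))
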